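/- For a set $S$ of primes let $\mathbb{Z}[S^{-1}]\subseteq\mathbb{Q}$ be the subring generated by the inverses $1/p$, $p\in S$. Fix a computable enumeration $f_0,f_1,f_2,\dots$ of all polynomials with integer coefficients (in any number of variables), and for a commutative ring $R$ let $\operatorname{HTP}(R)$ be the set of all indices $e$ such that $f_e$ has a zero with coordinates in $R$. Write $A\le_T B$ for Turing reducibility of sets of natural numbers. Given an infinite set $W=\{q_1,q_2,q_3,\dots\}$ enumerated without repetition, the relative upper (respectively lower) density in $W$ of a subset $S\subseteq W$, with respect to this enumeration, is the $\limsup$ (respectively $\liminf$), as $n\to\infty$, of $|S\cap\{q_1,\dots,q_n\}|/n$. **Theorem.** For every infinite computably enumerable set $W$ of primes and every computable enumeration $q_1,q_2,q_3,\dots$ of $W$ (without repetition), there exists a set $S\subseteq W$ such that $W\setminus S$ has relative upper density $1$ in $W$ and $\operatorname{HTP}(\mathbb{Z}[S^{-1}])\le_T\operatorname{HTP}(\mathbb{Z}[W^{-1}])$. In particular, $S$ has relative lower density $0$ in $W$. -/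

import Mathlib

open scoped Computability

noncomputable section

/-- The characteristic function of a set of natural numbers, as a (total) function `ℕ →. ℕ`. -/
def charFun (A : Set ℕ) : ℕ →. ℕ :=
  open Classical in fun n => Part.some (if n ∈ A then 1 else 0)

/-- `A ≤_T B` for sets of natural numbers: the characteristic function of `A` is computable
with an oracle for the characteristic function of `B`. -/
def SetTuringReducible (A B : Set ℕ) : Prop :=
  charFun A ≤ᵀ charFun B

/-- A code of a monomial: `((a, b), [k₀, k₁, …])` codes `(a - b) * X₀ ^ k₀ * X₁ ^ k₁ * ⋯`. -/
def monomialOfCode (t : (ℕ × ℕ) × List ℕ) : MvPolynomial ℕ ℤ :=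
  MvPolynomial.C ((t.1.1 : ℤ) - (t.1.2 : ℤ)) *
    ∏ i : Fin t.2.length, MvPolynomial.X (i : ℕ) ^ t.2.get i

/-- A list of codes of monomials codes the sum of these monomials. -/
def polyOfCode (l : List ((ℕ × ℕ) × List ℕ)) : MvPolynomial ℕ ℤ :=
  (l.map monomialOfCode).sum

/-- The computable enumeration `f₀, f₁, f₂, …` of all polynomials with integer coefficients, in
any number of variables, that is obtained from the standard bijection between the natural
numbers and the codes of polynomials. -/
def polyOfIndex (e : ℕ) : MvPolynomial ℕ ℤ :=
  polyOfCode (Denumerable.ofNat (List ((ℕ × ℕ) × List ℕ)) e)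

/-- Every polynomial occurs in the enumeration. -/
theorem polyOfIndex_surjective : Function.Surjective polyOfIndex := by
  have key : Function.Surjective polyOfCode := by
    intro f
    induction f using MvPolynomial.induction_on' with
    | monomial u a =>
      obtain ⟨N, hN⟩ : ∃ N : ℕ, ∀ i ∈ u.support, i < N :=
        ⟨u.support.sup id + 1, fun i hi =>
          Nat.lt_succ_of_le (Finset.le_sup (f := id) hi)⟩
      refine ⟨[((a.toNat, (-a).toNat), List.ofFn (fun i : Fin N => u i))], ?_⟩
      have ha : ((a.toNat : ℤ) - ((-a).toNat : ℤ)) = a := by omega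
      have hp : (∏ i : Fin (List.ofFn (fun i : Fin N => u i)).length,
          (MvPolynomial.X (i : ℕ) : MvPolynomial ℕ ℤ) ^
            (List.ofFn (fun i : Fin N => u i)).get i) =
          ∏ i ∈ Finset.range N, MvPolynomial.X i ^ u i := by
        rw [Finset.prod_range]
        refine Fintype.prod_equiv (finCongr (by simp)) _ _ ?_
        intro i
        simp
      simp only [polyOfCode, monomialOfCode, List.map_cons, List.map_nil, List.sum_cons,
        List.sum_nil, add_zero]
      rw [hp, ha, MvPolynomial.monomial_eq, Finsupp.prod]
      congr 1
      symm
      apply Finset.prod_subset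
      · intro i hi
        exact Finset.mem_range.2 (hN i hi)
      · intro i _ hi
        simp [Finsupp.notMem_support_iff.1 hi]
    | add p q hp hq =>
      obtain ⟨l, rfl⟩ := hp
      obtain ⟨m, rfl⟩ := hq
      exact ⟨l ++ m, by simp [polyOfCode]⟩
  intro f
  obtain ⟨l, rfl⟩ := key f
  exact ⟨Encodable.encode l, by simp [polyOfIndex]⟩

/-- `HTP(R)`: the set of the indices of the integer polynomials that have a zero in `R`.
(Only the finitely many values at variables that occur in the polynomial matter.) -/
def HTP (R : Type*) [CommRing R] : Set ℕ :=
  {e | ∃ x : ℕ → R, MvPolynomial.aeval x (polyOfIndex e) = 0}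

/-- The ring `ℤ[S⁻¹]`: the subring of `ℚ` generated by the inverses of the elements of `S`. -/
def invertRing (S : Set ℕ) : Subring ℚ :=
  Subring.closure ((fun p : ℕ => (p : ℚ)⁻¹) '' S)

/-- `q` is a computable enumeration of `W`, each element being listed exactly once. -/
structure IsComputableEnumeration (q : ℕ → ℕ) (W : Set ℕ) : Prop where
  computable : Computable q
  injective : Function.Injective q
  range_eq : Set.range q = W

/-- The proportion of elements of `S` among the first `n` elements `q 0, …, q (n - 1)`. -/
def relProportion (q : ℕ → ℕ) (S : Set ℕ) (n : ℕ) : ℝ :=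
  ((S ∩ q '' Set.Iio n).ncard : ℝ) / (n : ℝ)

/-- The upper density of `S` relative to the set enumerated by `q`. -/
def relUpperDensity (q : ℕ → ℕ) (S : Set ℕ) : ℝ :=
  Filter.limsup (relProportion q S) Filter.atTop

/-- The lower density of `S` relative to the set enumerated by `q`. -/
def relLowerDensity (q : ℕ → ℕ) (S : Set ℕ) : ℝ :=
  Filter.liminf (relProportion q S) Filter.atTop

end

/-! The set $S$ is built in stages together with finite sets of primes that are kept out of it for
ever. A state consists of a list $C$ of pairs of forbidden primes and a number $K$ whose prime
factors are in $S$. At stage $n$ the oracle is asked whether $f_n$ has a zero over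
$\mathbb{Z}[W^{-1}]$ whose coordinates are integral at all primes of $C$. If so, such a zero is
searched for and the prime factors of its common denominator $D$ join $S$; this settles $f_n$
positively. If not, no zero over $\mathbb{Z}[S^{-1}]$ can ever exist, since $S$ avoids $C$. So the
answers of the oracle are exactly $\operatorname{HTP}(\mathbb{Z}[S^{-1}])$.

Density is forced at the end of each stage. With $K$ replaced by $KD$, every odd prime among the
first $(K+1)(n+1)$ values of $q$ that does not divide $K$ is forbidden. At most $K+1$ of these
values can lie in $S$, a proportion of at most $1/(n+1)$.

The question must be a question about $\operatorname{HTP}(\mathbb{Z}[W^{-1}])$, so integrality at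
finitely many primes needs an existential definition. Primes are forbidden in pairs $(p,r)$ with $p$
odd, $r\equiv1\pmod 4$ and $r$ a nonresidue modulo $p$. The form $x^2-ry^2-pz^2+prM^2$ is the norm
form of the quaternion algebra $(r,p)$, and $M$ is a coordinate of an element of norm $1$ exactly if
$M$ is integral at $p$ and $r$ (`IsRamifiedPair.exists_iff`). One direction is a descent at $p$ and
at $r$. The other finds, by Dirichlet's theorem and reciprocity, a prime $t$ represented by two
forms, each representation coming from Legendre's theorem (`exists_zero_ternary`). The rational
auxiliary variables are brought into the ring by a common denominator
(`PolyCode.integralZeroIndex_mem_HTP`). -/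

/-! ### Legendre's theorem on ternary quadratic forms -/

/-- The box principle: three linear congruences with moduli `A`, `B`, `C` have a common nonzero
solution that is small. -/
theorem exists_small_solution {A B C : ℕ} (hA : 0 < A) (hB : 0 < B) (hC : 0 < C) (α β γ : ℤ) :
    ∃ x y z : ℤ, (x, y, z) ≠ 0 ∧ x ^ 2 ≤ B * C ∧ y ^ 2 ≤ A * C ∧ z ^ 2 ≤ A * B ∧
      (A : ℤ) ∣ y - α * z ∧ (B : ℤ) ∣ x - β * z ∧ (C : ℤ) ∣ x - γ * y := by
  have : NeZero A := ⟨hA.ne'⟩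
  have : NeZero B := ⟨hB.ne'⟩
  have : NeZero C := ⟨hC.ne'⟩
  set a := Nat.sqrt (B * C)
  set b := Nat.sqrt (A * C)
  set c := Nat.sqrt (A * B)
  let box : Finset (ℕ × ℕ × ℕ) :=
    Finset.range (a + 1) ×ˢ Finset.range (b + 1) ×ˢ Finset.range (c + 1)
  let f : ℕ × ℕ × ℕ → ZMod A × ZMod B × ZMod C := fun t =>
    ((t.2.1 : ZMod A) - α * t.2.2, (t.1 : ZMod B) - β * t.2.2, (t.1 : ZMod C) - γ * t.2.1)
  have hcard : (Finset.univ : Finset (ZMod A × ZMod B × ZMod C)).card < box.card := by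
    have h1 : B * C < (a + 1) * (a + 1) := Nat.lt_succ_sqrt _
    have h2 : A * C < (b + 1) * (b + 1) := Nat.lt_succ_sqrt _
    have h3 : A * B < (c + 1) * (c + 1) := Nat.lt_succ_sqrt _
    simp only [Finset.card_univ, Fintype.card_prod, ZMod.card, box, Finset.card_product,
      Finset.card_range]
    -- The left side is $(ABC)^2$ and the right side is the square of the size of the box.
    have h4 : (B * C) * ((A * C) * (A * B)) <
        ((a + 1) * (a + 1)) * (((b + 1) * (b + 1)) * ((c + 1) * (c + 1))) :=
      Nat.mul_lt_mul'' h1 (Nat.mul_lt_mul'' h2 h3)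
    by_contra hcon
    push Not at hcon
    have := Nat.mul_le_mul hcon hcon
    nlinarith
  obtain ⟨s, hs, t, ht, hst, hf⟩ := Finset.exists_ne_map_eq_of_card_lt_of_maps_to hcard
    (f := f) (fun x _ => Finset.mem_coe.2 (Finset.mem_univ _))
  obtain ⟨x, y, z⟩ := s
  obtain ⟨x', y', z'⟩ := t
  simp only [box, Finset.mem_product, Finset.mem_range, Nat.lt_succ_iff] at hs ht
  simp only [f, Prod.mk.injEq] at hf
  have small : ∀ {u v w n : ℕ}, u ≤ w → v ≤ w → w = Nat.sqrt n → ((u : ℤ) - v) ^ 2 ≤ n := by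
    intro u v w n hu hv hw
    have h1 : w * w ≤ n := hw ▸ Nat.sqrt_le n
    have h2 : ((w : ℤ)) * w ≤ n := by exact_mod_cast h1
    have hu' : (u : ℤ) ≤ w := by exact_mod_cast hu
    have hv' : (v : ℤ) ≤ w := by exact_mod_cast hv
    have := abs_le.2 ⟨(by linarith [Int.natCast_nonneg u] : -(w : ℤ) ≤ (u : ℤ) - v),
      by linarith [Int.natCast_nonneg v]⟩
    nlinarith [sq_le_sq' (by linarith [(abs_le.1 this).1]) (abs_le.1 this).2]
  refine ⟨x - x', y - y', z - z', ?_, ?_, ?_, ?_, ?_, ?_, ?_⟩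
  · intro h
    apply hst
    simp only [Prod.mk_eq_zero, sub_eq_zero, Nat.cast_inj] at h
    simp [h]
  · exact_mod_cast small hs.1 ht.1 rfl
  · exact_mod_cast small hs.2.1 ht.2.1 rfl
  · exact_mod_cast small hs.2.2 ht.2.2 rfl
  · rw [← ZMod.intCast_zmod_eq_zero_iff_dvd]
    push_cast
    linear_combination hf.1
  · rw [← ZMod.intCast_zmod_eq_zero_iff_dvd]
    push_cast
    linear_combination hf.2.1
  · rw [← ZMod.intCast_zmod_eq_zero_iff_dvd]
    push_cast
    linear_combination hf.2.2

/-- Legendre's theorem on `A x² + B y² = C z²`. -/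
theorem exists_zero_ternary {A B C : ℕ} (hA : 0 < A) (hB : 0 < B) (hC : 0 < C)
    (hAB : A.Coprime B) (hAC : A.Coprime C) (hBC : B.Coprime C)
    (sAB : ¬ IsSquare (A * B)) (sBC : ¬ IsSquare (B * C)) {α β γ : ℤ}
    (hα : (A : ℤ) ∣ B * α ^ 2 - C) (hβ : (B : ℤ) ∣ A * β ^ 2 - C) (hγ : (C : ℤ) ∣ A * γ ^ 2 + B) :
    ∃ x y z : ℤ, (x, y, z) ≠ 0 ∧ A * x ^ 2 + B * y ^ 2 = C * z ^ 2 := by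
  obtain ⟨x, y, z, h0, hx, hy, hz, h1, h2, h3⟩ := exists_small_solution hA hB hC α β γ
  set Q : ℤ := A * x ^ 2 + B * y ^ 2 - C * z ^ 2 with hQ
  -- The linear congruences make $Q$ vanish modulo each of $A$, $B$, $C$, hence modulo $ABC$ by
  -- coprimality.
  have dA : (A : ℤ) ∣ Q := by
    have : Q = A * x ^ 2 + B * (y + α * z) * (y - α * z) + (B * α ^ 2 - C) * z ^ 2 := by
      rw [hQ]; ring
    rw [this]
    exact ((dvd_mul_right _ _).add (h1.mul_left _)).add (hα.mul_right _)
  have dB : (B : ℤ) ∣ Q := by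
    have : Q = B * y ^ 2 + A * (x + β * z) * (x - β * z) + (A * β ^ 2 - C) * z ^ 2 := by
      rw [hQ]; ring
    rw [this]
    exact ((dvd_mul_right _ _).add (h2.mul_left _)).add (hβ.mul_right _)
  have dC : (C : ℤ) ∣ Q := by
    have : Q = C * (-z ^ 2) + A * (x + γ * y) * (x - γ * y) + (A * γ ^ 2 + B) * y ^ 2 := by
      rw [hQ]; ring
    rw [this]
    exact ((dvd_mul_right _ _).add (h3.mul_left _)).add (hγ.mul_right _)
  obtain ⟨k, hk⟩ : ((A * B * C : ℕ) : ℤ) ∣ Q := by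
    push_cast
    have cAB : IsCoprime (A : ℤ) B := Nat.isCoprime_iff_coprime.2 hAB
    have cAC : IsCoprime (A : ℤ) C := Nat.isCoprime_iff_coprime.2 hAC
    have cBC : IsCoprime (B : ℤ) C := Nat.isCoprime_iff_coprime.2 hBC
    exact (cAC.mul_left cBC).mul_dvd (cAB.mul_dvd dA dB) dC
  have hA' : (0 : ℤ) < A := by exact_mod_cast hA
  have hB' : (0 : ℤ) < B := by exact_mod_cast hB
  have hC' : (0 : ℤ) < C := by exact_mod_cast hC
  have nonsq : ∀ {w : ℤ} {n : ℕ}, ¬ IsSquare n → w ^ 2 ≤ (n : ℤ) → w ^ 2 < (n : ℤ) := by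
    intro w n hn h
    refine lt_of_le_of_ne h fun he => hn ⟨w.natAbs, ?_⟩
    zify
    rw [abs_mul_abs_self, ← he, sq]
  have hx' : x ^ 2 < (B : ℤ) * C := by exact_mod_cast nonsq sBC (by exact_mod_cast hx)
  have hz' : z ^ 2 < (A : ℤ) * B := by exact_mod_cast nonsq sAB (by exact_mod_cast hz)
  have pos : (0 : ℤ) < A * B * C := by positivity
  push_cast at hk
  -- Because $AB$ and $BC$ are not squares, the bounds on $z^2$ and $x^2$ are strict, whence
  -- $-ABC<Q<2ABC$.
  have l1 : (-1 : ℤ) < k := by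
    have : -((A : ℤ) * B * C) < Q := by
      nlinarith [mul_lt_mul_of_pos_left hz' hC', mul_nonneg hA'.le (sq_nonneg x),
        mul_nonneg hB'.le (sq_nonneg y)]
    by_contra hcon
    nlinarith
  have l2 : k < 2 := by
    have : Q < 2 * ((A : ℤ) * B * C) := by
      nlinarith [mul_lt_mul_of_pos_left hx' hA', mul_le_mul_of_nonneg_left hy hB'.le,
        mul_nonneg hC'.le (sq_nonneg z)]
    by_contra hcon
    nlinarith
  obtain rfl | rfl : k = 0 ∨ k = 1 := by omega
  · exact ⟨x, y, z, h0, by linarith⟩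
  -- If $Ax^2+By^2=C(z^2+AB)$, multiply by $z^2+AB$ and use
  -- $A(xz+By)^2+B(yz-Ax)^2=(z^2+AB)(Ax^2+By^2)$.
  · refine ⟨x * z + B * y, y * z - A * x, z ^ 2 + A * B, ?_, ?_⟩
    · intro h
      simp only [Prod.mk_eq_zero] at h
      nlinarith [sq_nonneg z, mul_pos hA' hB']
    · linear_combination (z ^ 2 + A * B : ℤ) * (hk - hQ)

theorem not_isSquare_prime_mul {p m : ℕ} (hp : p.Prime) (h : p.Coprime m) :
    ¬ IsSquare (p * m) := by
  rintro ⟨w, hw⟩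
  have h1 : p ∣ w := by
    have : p ∣ w * w := hw ▸ dvd_mul_right p m
    exact (hp.dvd_mul.1 this).elim id id
  have h2 : p * p ∣ p * m := hw ▸ mul_dvd_mul h1 h1
  exact (hp.coprime_iff_not_dvd.1 h) (Nat.dvd_of_mul_dvd_mul_left hp.pos h2)

/-- For $y\ne0$ the $p$-adic valuation would be even on the left and odd on the right. -/
theorem eq_zero_of_mul_sq_eq_mul_sq {p : ℕ} (hp : p.Prime) {c x y : ℤ} (hc : ¬ (p : ℤ) ∣ c)
    (h : c * x ^ 2 = p * y ^ 2) : y = 0 := by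
  by_contra hy
  have hp' : Prime (p : ℤ) := Nat.prime_iff_prime_int.1 hp
  have hx : x ≠ 0 := by
    rintro rfl
    have : (p : ℤ) * y ^ 2 ≠ 0 := mul_ne_zero hp'.ne_zero (pow_ne_zero 2 hy)
    exact this (by rw [← h]; ring)
  have hf : ∀ {z : ℤ}, z ≠ 0 → FiniteMultiplicity (p : ℤ) z := fun hz =>
    Int.finiteMultiplicity_iff.2 ⟨by simpa using hp.ne_one, hz⟩
  have h1 := congrArg (emultiplicity (p : ℤ)) h
  rw [emultiplicity_mul hp', emultiplicity_mul hp', emultiplicity_pow hp', emultiplicity_pow hp',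
    emultiplicity_eq_zero.2 hc,
    (hf hx).emultiplicity_eq_multiplicity, (hf hy).emultiplicity_eq_multiplicity,
    (hf hp'.ne_zero).emultiplicity_eq_multiplicity, multiplicity_self] at h1
  norm_cast at h1
  omega

/-! ### Representations of a common auxiliary prime -/

/-- An auxiliary prime for which the two ternary forms below are locally isotropic. -/
theorem exists_auxiliary_prime {p r : ℕ} (hp : p.Prime) (hp2 : p ≠ 2) (hr : r.Prime)
    (hr4 : r % 4 = 1) {N n : ℤ} (hN0 : N ≠ 0) (hpN : ¬ (p : ℤ) ∣ N)
    (hrN : ¬ (r : ℤ) ∣ N) (hNn : (p : ℤ) ∣ N - n ^ 2) (hpn : ¬ (p : ℤ) ∣ n) :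
    ∃ t : ℕ, t.Prime ∧ N.natAbs < t ∧ p < t ∧ r < t ∧ t ≡ p [MOD N.natAbs] ∧ t ≡ 1 [MOD p] ∧
      t ≡ 1 [MOD r] ∧ jacobiSym r t = 1 ∧ jacobiSym (-(N * p)) t = 1 := by
  have hpo : Odd p := hp.odd_of_ne_two hp2
  have hro : Odd r := by rw [Nat.odd_iff]; omega
  set a := N.natAbs with ha
  have ha0 : a ≠ 0 := Int.natAbs_ne_zero.2 hN0
  have cpa : p.Coprime a := hp.coprime_iff_not_dvd.2 fun h => hpN (Int.natCast_dvd.2 h)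
  have cra : r.Coprime a := hr.coprime_iff_not_dvd.2 fun h => hrN (Int.natCast_dvd.2 h)
  have c8 : ∀ {s : ℕ}, Odd s → s.Coprime 8 := fun hs => by
    have := Nat.Coprime.pow_right 3 (Nat.coprime_two_right.2 hs)
    simpa using this
  have cp : p.Coprime (8 * a) := (c8 hpo).mul_right cpa
  have cr : r.Coprime (8 * a) := (c8 hro).mul_right cra
  have cM : (8 * a).Coprime (p * r) := cp.symm.mul_right cr.symm
  -- The class $p$ modulo $8|N|$ gives $t\equiv p\pmod 4$ and $(N/t)=(N/p)=1$; the class $1$ modulo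
  -- $pr$ gives $(t/p)=(t/r)=1$.
  obtain ⟨k, hk1, hk2⟩ := Nat.chineseRemainder cM p 1
  have hk : k.Coprime (8 * a * (p * r)) := by
    refine Nat.Coprime.mul_right ?_ ?_
    · exact (hk1.gcd_eq.trans cp)
    · have := hk2.gcd_eq
      rw [Nat.gcd_one_left] at this
      exact this
  obtain ⟨t, htgt, ht, htk⟩ := Nat.forall_exists_prime_gt_and_modEq (a + p + r)
    (by have := hp.ne_zero; have := hr.ne_zero; positivity) hk
  have t8 : t ≡ p [MOD 8 * a] := (htk.of_mul_right _).trans hk1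
  have tpr : t ≡ 1 [MOD p * r] := (htk.of_mul_left _).trans hk2
  have tp : t ≡ 1 [MOD p] := tpr.of_mul_right _
  have tr : t ≡ 1 [MOD r] := tpr.of_mul_left _
  have htodd : Odd t := ht.odd_of_ne_two (by have := hp.two_le; have := hr.two_le; omega)
  have t4a : t ≡ p [MOD 4 * a] := by
    refine t8.of_dvd ⟨2, by ring⟩
  have t4 : t ≡ p [MOD 4] := t4a.of_mul_right _
  have jone : ∀ {s : ℕ}, t ≡ 1 [MOD s] → jacobiSym t s = 1 := by
    intro s hs
    rw [jacobiSym.mod_left' (a₂ := 1), jacobiSym.one_left]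
    exact_mod_cast hs
  refine ⟨t, ht, by omega, by omega, by omega, t8.of_mul_left _, tp, tr, ?_, ?_⟩
  · rw [jacobiSym.quadratic_reciprocity_one_mod_four hr4 htodd, jone tr]
  · have h1 : jacobiSym N t = 1 := by
      have e1 := jacobiSym.mod_right N htodd
      have e2 := jacobiSym.mod_right N hpo
      rw [e1, show t % (4 * N.natAbs) = p % (4 * N.natAbs) from t4a, ← e2,
        jacobiSym.mod_left' (a₂ := n ^ 2), jacobiSym.sq_one']
      · rw [Int.gcd_comm]
        exact Int.isCoprime_iff_gcd_eq_one.1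
          ((Prime.coprime_iff_not_dvd (Nat.prime_iff_prime_int.1 hp)).2 hpn)
      · exact (Int.modEq_iff_dvd.2 hNn).symm
    -- As $t\equiv p\pmod 4$, the sign of $(-1/t)$ cancels the sign in the reciprocity law for
    -- $(p/t)$.
    have h2 : jacobiSym (-p) t = 1 := by
      rw [jacobiSym.neg _ htodd]
      have hp4 : p % 4 = 1 ∨ p % 4 = 3 := by have := Nat.odd_iff.1 hpo; omega
      have t4' : t % 4 = p % 4 := t4
      rcases hp4 with h | h
      · rw [jacobiSym.quadratic_reciprocity_one_mod_four h htodd, jone tp,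
          ZMod.χ₄_nat_one_mod_four (by omega)]
        rfl
      · rw [jacobiSym.quadratic_reciprocity_three_mod_four h (by omega), jone tp,
          ZMod.χ₄_nat_three_mod_four (by omega)]
        rfl
    rw [show -(N * p) = N * (-p : ℤ) by ring, jacobiSym.mul_left, h1, h2, one_mul]

theorem exists_int_of_isSquare {t : ℕ} [Fact t.Prime] {c : ℤ} (h : jacobiSym c t = 1) :
    ∃ s : ZMod t, (c : ZMod t) = s ^ 2 ∧ s ≠ 0 := by
  obtain ⟨s, hs⟩ := ZMod.isSquare_of_jacobiSym_eq_one h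
  refine ⟨s, by rw [hs, sq], ?_⟩
  rintro rfl
  rw [mul_zero, ZMod.intCast_zmod_eq_zero_iff_dvd] at hs
  rw [← jacobiSym.mod_left' (a₁ := 0) (by simpa using (Int.emod_eq_zero_of_dvd hs).symm),
    jacobiSym.zero_left (Fact.out : t.Prime).one_lt] at h
  exact zero_ne_one h

/-- A prime that is `1` modulo the prime `r` and modulo which `r` is a square is a norm from
`ℚ(√r)`. -/
theorem exists_sq_sub_mul_sq_eq {r t : ℕ} (hr : r.Prime) (ht : t.Prime) (hrt : r < t)
    (h1 : t ≡ 1 [MOD r]) (hj : jacobiSym r t = 1) :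
    ∃ x y : ℚ, x ^ 2 - r * y ^ 2 = t := by
  have : Fact t.Prime := ⟨ht⟩
  have crt : r.Coprime t := (Nat.coprime_primes hr ht).2 hrt.ne
  obtain ⟨s, hs, hs0⟩ := exists_int_of_isSquare hj
  obtain ⟨β, hβ⟩ := ZMod.intCast_surjective s⁻¹
  obtain ⟨y, v, x, h0, h⟩ := exists_zero_ternary (A := r) (B := t) (C := 1) hr.pos ht.pos one_pos
    crt (by simp) (by simp) (not_isSquare_prime_mul hr crt)
    (not_isSquare_prime_mul ht (by simp)) (α := 1) (β := β) (γ := 0)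
    (by
      have := (Nat.modEq_iff_dvd.1 h1.symm)
      simpa using this)
    (by
      rw [← ZMod.intCast_zmod_eq_zero_iff_dvd]
      push_cast
      push_cast at hs
      rw [hβ, hs]
      field_simp
      simp)
    (by simp)
  have hv : v ≠ 0 := by
    rintro rfl
    have hy : y = 0 := eq_zero_of_mul_sq_eq_mul_sq hr (c := 1) (x := x)
      (by simpa [Int.natCast_dvd] using hr.ne_one) (by push_cast at h; linarith)
    subst hy
    apply h0
    have : x ^ 2 = 0 := by push_cast at h; linarith
    simpa using this
  have hv' : (v : ℚ) ≠ 0 := by exact_mod_cast hv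
  have h' : (r : ℚ) * y ^ 2 + t * v ^ 2 = x ^ 2 := by
    have := congrArg (fun z : ℤ => (z : ℚ)) h
    push_cast at this
    linarith
  refine ⟨x / v, y / v, ?_⟩
  field_simp
  linarith

/-- For the auxiliary prime `t`, the form `N w² + p z²` represents `t` with `w ≠ 0`. -/
theorem exists_mul_sq_add_mul_sq_eq {p t : ℕ} {N n : ℤ} (hp : p.Prime) (ht : t.Prime) (hpt : p < t)
    (hNt : N.natAbs < t) (hN0 : N ≠ 0) (hpN : ¬ (p : ℤ) ∣ N) (hNn : (p : ℤ) ∣ N - n ^ 2)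
    (hpn : ¬ (p : ℤ) ∣ n) (h1 : t ≡ p [MOD N.natAbs]) (h2 : t ≡ 1 [MOD p])
    (hj : jacobiSym (-(N * p)) t = 1) :
    ∃ w z : ℚ, w ≠ 0 ∧ N * w ^ 2 + p * z ^ 2 = t := by
  have : Fact t.Prime := ⟨ht⟩
  have : Fact p.Prime := ⟨hp⟩
  have cpt : p.Coprime t := (Nat.coprime_primes hp ht).2 hpt.ne
  have ha0 : 0 < N.natAbs := Int.natAbs_pos.2 hN0
  have cat : N.natAbs.Coprime t := (((Nat.Prime.coprime_iff_not_dvd ht).2 (Nat.not_dvd_of_pos_of_lt ha0 hNt)).symm)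
  have cpa : p.Coprime N.natAbs :=
    hp.coprime_iff_not_dvd.2 fun h => hpN (Int.natCast_dvd.2 h)
  obtain ⟨s, hs, hs0⟩ := exists_int_of_isSquare hj
  have hNt0 : (N : ZMod t) ≠ 0 := by
    rw [Ne, ZMod.intCast_zmod_eq_zero_iff_dvd, Int.natCast_dvd]
    exact Nat.not_dvd_of_pos_of_lt ha0 hNt
  have hn0 : (n : ZMod p) ≠ 0 := by
    rwa [Ne, ZMod.intCast_zmod_eq_zero_iff_dvd]
  have hNp : (N : ZMod p) = n ^ 2 := by
    rw [← sub_eq_zero]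
    exact_mod_cast (ZMod.intCast_zmod_eq_zero_iff_dvd _ _).2 hNn
  have htp : (t : ZMod p) = 1 := by
    exact_mod_cast (ZMod.natCast_eq_natCast_iff _ _ _).2 h2
  obtain ⟨β, hβ⟩ := ZMod.intCast_surjective (n : ZMod p)⁻¹
  obtain ⟨γ, hγ⟩ := ZMod.intCast_surjective (s / (N : ZMod t))
  have d1 : (N.natAbs : ℤ) ∣ p - t := Nat.modEq_iff_dvd.1 h1
  push_cast at hs
  obtain ⟨w, z, v, h0, h⟩ : ∃ w z v : ℤ, (w, z, v) ≠ 0 ∧ N * w ^ 2 + p * z ^ 2 = t * v ^ 2 := by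
    -- Legendre's theorem is stated for positive coefficients. For $N<0$ the equation is rearranged
    -- as $|N|w^2+tv^2=pz^2$.
    rcases lt_or_gt_of_ne hN0 with hN | hN
    · have hNa : (N.natAbs : ℤ) = -N := by omega
      have hNa' : ∀ m : ℕ, (N.natAbs : ZMod m) = -N := fun m => by
        have := congrArg (fun z : ℤ => (z : ZMod m)) hNa
        rwa [Int.cast_natCast, Int.cast_neg] at this
      obtain ⟨w, v, z, h0, h⟩ := exists_zero_ternary (A := N.natAbs) (B := t) (C := p) ha0 ht.pos
        hp.pos cat cpa.symm cpt.symm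
        (by rw [mul_comm]; exact not_isSquare_prime_mul ht cat.symm)
        (not_isSquare_prime_mul ht cpt.symm) (α := 1) (β := γ) (γ := β)
        (by simpa using (dvd_neg.2 d1))
        (by
          rw [← ZMod.intCast_zmod_eq_zero_iff_dvd]
          simp only [Int.cast_sub, Int.cast_mul, Int.cast_pow, Int.cast_natCast, hγ, hNa']
          field_simp
          linear_combination hs)
        (by
          rw [← ZMod.intCast_zmod_eq_zero_iff_dvd]
          simp only [Int.cast_add, Int.cast_mul, Int.cast_pow, Int.cast_natCast, hβ, hNa', hNp,
            htp]
          field_simp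
          simp)
      refine ⟨w, z, v, fun hz => h0 ?_, ?_⟩
      · simp only [Prod.mk_eq_zero] at hz ⊢
        tauto
      · rw [hNa] at h
        linarith
    · have hNa : (N.natAbs : ℤ) = N := by omega
      have hNa' : ∀ m : ℕ, (N.natAbs : ZMod m) = N := fun m => by
        have := congrArg (fun z : ℤ => (z : ZMod m)) hNa
        rwa [Int.cast_natCast] at this
      obtain ⟨w, z, v, h0, h⟩ := exists_zero_ternary (A := N.natAbs) (B := p) (C := t) ha0 hp.pos
        ht.pos cpa.symm cat cpt
        (by rw [mul_comm]; exact not_isSquare_prime_mul hp cpa)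
        (not_isSquare_prime_mul hp cpt) (α := 1) (β := β) (γ := γ)
        (by simpa using d1)
        (by
          rw [← ZMod.intCast_zmod_eq_zero_iff_dvd]
          simp only [Int.cast_sub, Int.cast_mul, Int.cast_pow, Int.cast_natCast, hβ, hNa', hNp,
            htp]
          field_simp
          simp)
        (by
          rw [← ZMod.intCast_zmod_eq_zero_iff_dvd]
          simp only [Int.cast_add, Int.cast_mul, Int.cast_pow, Int.cast_natCast, hγ, hNa']
          field_simp
          linear_combination -hs)
      exact ⟨w, z, v, h0, by rw [hNa] at h; exact h⟩
  -- With $w=0$ the equation becomes $pz^2=tv^2$, impossible by parity of the $p$-adic valuation;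
  -- the case $v=0$ is excluded likewise, since $p\nmid N$.
  have hw : w ≠ 0 := by
    rintro rfl
    have hz : z = 0 := eq_zero_of_mul_sq_eq_mul_sq hp (c := t) (x := v)
      (fun hd => (hp.coprime_iff_not_dvd.1 cpt) (by exact_mod_cast hd)) (by linarith)
    subst hz
    apply h0
    have ht0 : t ≠ 0 := ht.ne_zero
    have : (t : ℤ) * v ^ 2 = 0 := by linarith
    have hv : v = 0 := by simpa [ht0] using this
    simp [hv]
  have hv : v ≠ 0 := by
    rintro rfl
    have hz : z = 0 := eq_zero_of_mul_sq_eq_mul_sq hp (c := -N) (x := w)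
      (by rwa [dvd_neg]) (by linarith)
    subst hz
    have : N * w ^ 2 = 0 := by linarith
    exact hw (by simpa [hN0] using this)
  have hv' : (v : ℚ) ≠ 0 := by exact_mod_cast hv
  have hw' : (w : ℚ) ≠ 0 := by exact_mod_cast hw
  have h' : (N : ℚ) * w ^ 2 + p * z ^ 2 = t * v ^ 2 := by exact_mod_cast h
  refine ⟨w / v, z / v, div_ne_zero hw' hv', ?_⟩
  field_simp
  linarith

/-- Every `n² - p r m²` with `n` prime to `p r` is represented by `x² - r y² - p z²`. -/
theorem exists_ternary_eq_sq_sub {p r : ℕ} (hp : p.Prime) (hp2 : p ≠ 2) (hr : r.Prime)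
    (hr4 : r % 4 = 1) {n m : ℤ} (hpn : ¬ (p : ℤ) ∣ n) (hrn : ¬ (r : ℤ) ∣ n) :
    ∃ x y z : ℚ, x ^ 2 - r * y ^ 2 - p * z ^ 2 = (n : ℚ) ^ 2 - p * r * m ^ 2 := by
  set N : ℤ := n ^ 2 - p * r * m ^ 2 with hN
  have hp' : Prime (p : ℤ) := Nat.prime_iff_prime_int.1 hp
  have hr' : Prime (r : ℤ) := Nat.prime_iff_prime_int.1 hr
  have hpN : ¬ (p : ℤ) ∣ N := fun h => hpn <| hp'.dvd_of_dvd_pow (n := 2) <| by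
    have := h.add (Dvd.intro (r * m ^ 2) rfl : (p : ℤ) ∣ p * (r * m ^ 2))
    rwa [hN, show n ^ 2 - p * r * m ^ 2 + p * (r * m ^ 2) = n ^ 2 by ring] at this
  have hrN : ¬ (r : ℤ) ∣ N := fun h => hrn <| hr'.dvd_of_dvd_pow (n := 2) <| by
    have := h.add (Dvd.intro (p * m ^ 2) rfl : (r : ℤ) ∣ r * (p * m ^ 2))
    rwa [hN, show n ^ 2 - p * r * m ^ 2 + r * (p * m ^ 2) = n ^ 2 by ring] at this
  have hN0 : N ≠ 0 := fun h => hpN (h ▸ dvd_zero _)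
  have hNn : (p : ℤ) ∣ N - n ^ 2 := ⟨-(r * m ^ 2), by rw [hN]; ring⟩
  obtain ⟨t, ht, hNt, hpt, hrt, t1, t2, t3, j1, j2⟩ :=
    exists_auxiliary_prime hp hp2 hr hr4 hN0 hpN hrN hNn hpn
  obtain ⟨x, y, hxy⟩ := exists_sq_sub_mul_sq_eq hr ht hrt t3 j1
  obtain ⟨w, z, hw, hwz⟩ := exists_mul_sq_add_mul_sq_eq hp ht hpt hNt hN0 hpN hNn hpn t1 t2 j2
  -- Divide $x^2-ry^2=t=Nw^2+pz^2$ by $w^2$.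
  refine ⟨x / w, y / w, z / w, ?_⟩
  have hNq : (N : ℚ) = (n : ℚ) ^ 2 - p * r * m ^ 2 := by rw [hN]; push_cast; ring
  rw [← hNq]
  field_simp
  linarith

/-! ### Existential definition of integrality at a ramified pair -/

/-- Descent on $D$. If $p\mid D$, then $p\mid X^2-rY^2$, and since $r$ is a nonresidue $p$ divides
$X$ and $Y$. Dividing by $p$, the same argument applies to $Z^2-rM^2$, so the common factor $p$ can
be cancelled. -/
theorem exists_coprime_denominator {p r : ℕ} [Fact p.Prime] (h : jacobiSym r p = -1) :
    ∀ (D : ℕ) (X Y Z M : ℤ), 0 < D → X ^ 2 - r * Y ^ 2 - p * (Z ^ 2 - r * M ^ 2) = (D : ℤ) ^ 2 →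
      ∃ a b : ℤ, ¬ (p : ℤ) ∣ b ∧ (M : ℚ) / D = a / b := by
  intro D
  induction D using Nat.strong_induction_on with
  | _ D ih =>
    intro X Y Z M hD heq
    by_cases hpD : p ∣ D
    · have hp0 : (p : ℤ) ≠ 0 := by exact_mod_cast (Fact.out : p.Prime).ne_zero
      obtain ⟨D', rfl⟩ := hpD
      push_cast at heq
      obtain ⟨⟨X', rfl⟩, ⟨Y', rfl⟩⟩ := jacobiSym.prime_dvd_of_eq_neg_one h (x := X) (y := Y)
        ⟨Z ^ 2 - r * M ^ 2 + p * D' ^ 2, by linear_combination heq⟩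
      have heq2 : p * (X' ^ 2 - r * Y' ^ 2) - (Z ^ 2 - r * M ^ 2) = p * (D' : ℤ) ^ 2 :=
        mul_left_cancel₀ hp0 (by linear_combination heq)
      obtain ⟨⟨Z', rfl⟩, ⟨M', rfl⟩⟩ := jacobiSym.prime_dvd_of_eq_neg_one h (x := Z) (y := M)
        ⟨X' ^ 2 - r * Y' ^ 2 - D' ^ 2, by linear_combination -heq2⟩
      have hD' : 0 < D' := Nat.pos_of_mul_pos_left hD
      obtain ⟨a, b, hb, hab⟩ := ih D' (lt_mul_left hD' (Fact.out : p.Prime).one_lt) X' Y' Z' M' hD'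
        (mul_left_cancel₀ hp0 (by linear_combination heq2))
      refine ⟨a, b, hb, ?_⟩
      rw [← hab]
      have : (p : ℚ) ≠ 0 := by exact_mod_cast hp0
      push_cast
      rw [mul_div_mul_left _ _ this]
    · exact ⟨M, D, by exact_mod_cast hpD, by push_cast; rfl⟩

/-- Only the nonresidue condition at $p$ enters, so the statement can be used a second time with $p$
and $r$, and $y$ and $z$, interchanged. -/
theorem not_dvd_den_of_eq {p r : ℕ} (hp : p.Prime) (h : jacobiSym r p = -1) {x y z M : ℚ}
    (heq : x ^ 2 - r * y ^ 2 - p * (z ^ 2 - r * M ^ 2) = 1) : ¬ p ∣ M.den := by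
  have : Fact p.Prime := ⟨hp⟩
  have hx := Rat.num_div_den x
  have hy := Rat.num_div_den y
  have hz := Rat.num_div_den z
  have hM := Rat.num_div_den M
  have hx0 : (x.den : ℚ) ≠ 0 := by exact_mod_cast x.den_ne_zero
  have hy0 : (y.den : ℚ) ≠ 0 := by exact_mod_cast y.den_ne_zero
  have hz0 : (z.den : ℚ) ≠ 0 := by exact_mod_cast z.den_ne_zero
  have hM0 : (M.den : ℚ) ≠ 0 := by exact_mod_cast M.den_ne_zero
  obtain ⟨a, b, hb, hab⟩ := exists_coprime_denominator h (x.den * y.den * z.den * M.den)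
    (x.num * y.den * z.den * M.den) (y.num * x.den * z.den * M.den)
    (z.num * x.den * y.den * M.den) (M.num * x.den * y.den * z.den)
    (by have := x.den_pos; have := y.den_pos; have := z.den_pos; have := M.den_pos; positivity)
    (by
      rw [← hx, ← hy, ← hz, ← hM] at heq
      field_simp at heq
      have : ((x.num * y.den * z.den * M.den : ℤ) ^ 2 - r * (y.num * x.den * z.den * M.den : ℤ) ^ 2
        - p * ((z.num * x.den * y.den * M.den : ℤ) ^ 2
          - r * (M.num * x.den * y.den * z.den : ℤ) ^ 2) : ℚ)
          = ((x.den * y.den * z.den * M.den : ℕ) : ℚ) ^ 2 := by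
        push_cast
        linear_combination heq
      exact_mod_cast this)
  have hMab : M = a / b := by
    rw [← hab, ← hM]
    push_cast
    rw [Rat.num_div_den]
    field_simp
    rw [Rat.mul_den_eq_num]
  intro hd
  apply hb
  rw [hMab, ← Rat.divInt_eq_div] at hd
  exact (Int.natCast_dvd_natCast.2 hd).trans (Rat.den_dvd a b)

/-- A pair `(p, r)` of distinct primes, for which the quaternion algebra `(r, p)` is ramified
exactly at `p` and `r`. -/
def IsRamifiedPair (c : ℕ × ℕ) : Prop :=
  c.1.Prime ∧ c.1 ≠ 2 ∧ c.2.Prime ∧ c.2 % 4 = 1 ∧ ∀ x < c.1, x * x % c.1 ≠ c.2 % c.1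

theorem IsRamifiedPair.jacobiSym_eq {p r : ℕ} (h : IsRamifiedPair (p, r)) :
    jacobiSym r p = -1 := by
  obtain ⟨hp, -, hr, -, hn⟩ := h
  have : Fact p.Prime := ⟨hp⟩
  apply ZMod.nonsquare_iff_jacobiSym_eq_neg_one.2
  rintro ⟨s, hs⟩
  apply hn s.val s.val_lt
  rw [← ZMod.val_mul, ← hs]
  simp [ZMod.val_natCast]

theorem IsRamifiedPair.jacobiSym_eq' {p r : ℕ} (h : IsRamifiedPair (p, r)) :
    jacobiSym p r = -1 := by
  rw [jacobiSym.quadratic_reciprocity_one_mod_four' (h.1.odd_of_ne_two h.2.1) h.2.2.2.1,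
    h.jacobiSym_eq]

/-- The existential definition in `ℚ` of the rational numbers that are integral at both primes
of a ramified pair. -/
theorem IsRamifiedPair.exists_iff {p r : ℕ} (h : IsRamifiedPair (p, r)) (M : ℚ) :
    (∃ x y z : ℚ, x ^ 2 - r * y ^ 2 - p * z ^ 2 + p * r * M ^ 2 = 1) ↔
      ¬ p ∣ M.den ∧ ¬ r ∣ M.den := by
  constructor
  · rintro ⟨x, y, z, heq⟩
    exact ⟨not_dvd_den_of_eq h.1 h.jacobiSym_eq (x := x) (y := y) (z := z) (by linarith),
      not_dvd_den_of_eq h.2.2.1 h.jacobiSym_eq' (x := x) (y := z) (z := y) (by linarith)⟩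
  · rintro ⟨h1, h2⟩
    obtain ⟨x, y, z, heq⟩ := exists_ternary_eq_sq_sub h.1 h.2.1 h.2.2.1 h.2.2.2.1 (n := M.den)
      (m := M.num) (by exact_mod_cast h1) (by exact_mod_cast h2)
    have hM0 : (M.den : ℚ) ≠ 0 := by exact_mod_cast M.den_ne_zero
    refine ⟨x / M.den, y / M.den, z / M.den, ?_⟩
    rw [← Rat.mul_den_eq_num] at heq
    push_cast at heq
    field_simp
    linarith

/-- Every odd prime is the first component of a ramified pair whose second component avoids
finitely many given primes. -/
theorem exists_isRamifiedPair {p : ℕ} (hp : p.Prime) (hp2 : p ≠ 2) (K : ℕ) :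
    ∃ r > K, IsRamifiedPair (p, r) := by
  have : Fact p.Prime := ⟨hp⟩
  obtain ⟨a, ha⟩ := FiniteField.exists_nonsquare (F := ZMod p) (by rwa [ZMod.ringChar_zmod_n])
  have c4 : p.Coprime 4 := by
    have := Nat.Coprime.pow_right 2 (Nat.coprime_two_right.2 (hp.odd_of_ne_two hp2))
    simpa using this
  -- Dirichlet's theorem is applied to a class that is a nonsquare modulo $p$ and $1$ modulo $4$.
  obtain ⟨k, hk1, hk2⟩ := Nat.chineseRemainder c4 a.val 1
  have ha0 : a ≠ 0 := by
    rintro rfl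
    exact ha (by simp)
  have hk : k.Coprime (p * 4) := by
    refine Nat.Coprime.mul_right ?_ ?_
    · refine ((hp.coprime_iff_not_dvd).2 fun hd => ha0 ?_).symm
      have h1 : a.val ≡ 0 [MOD p] := hk1.symm.trans ((Nat.modEq_zero_iff_dvd).2 hd)
      have := (ZMod.natCast_eq_natCast_iff _ _ _).2 h1
      simpa using this
    · have := hk2.gcd_eq
      rwa [Nat.gcd_one_left] at this
  obtain ⟨r, hrK, hr, hrk⟩ := Nat.forall_exists_prime_gt_and_modEq K
    (by have := hp.ne_zero; positivity) hk
  refine ⟨r, hrK, hp, hp2, hr, ?_, ?_⟩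
  · exact (hrk.of_mul_left _).trans hk2
  · intro x _ hx
    apply ha
    have h1 : r ≡ a.val [MOD p] := (hrk.of_mul_right _).trans hk1
    have h2 : x * x ≡ a.val [MOD p] := Nat.ModEq.trans hx h1
    have := (ZMod.natCast_eq_natCast_iff _ _ _).2 h2
    refine ⟨(x : ZMod p), ?_⟩
    push_cast at this
    simpa using this.symm

/-! ### Denominators in $\mathbb{Z}[S^{-1}]$ -/

theorem mem_invertRing_iff {S : Set ℕ} (hS : ∀ p ∈ S, p.Prime) (x : ℚ) :
    x ∈ invertRing S ↔ ∀ p : ℕ, p.Prime → p ∣ x.den → p ∈ S := by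
  constructor
  · intro hx
    induction hx using Subring.closure_induction with
    | mem x hx =>
      obtain ⟨q, hq, rfl⟩ := hx
      intro p hp hd
      have hq0 := (hS q hq).pos
      rw [Rat.inv_natCast_den_of_pos hq0] at hd
      rwa [(Nat.prime_dvd_prime_iff_eq hp (hS q hq)).1 hd]
    | zero => intro p hp hd; exact absurd (Nat.dvd_one.1 hd) hp.ne_one
    | one => intro p hp hd; exact absurd (Nat.dvd_one.1 hd) hp.ne_one
    | add x y _ _ hx hy =>
      intro p hp hd
      exact (hp.dvd_mul.1 (hd.trans (Rat.add_den_dvd x y))).elim (hx p hp) (hy p hp)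
    | neg x _ hx => intro p hp hd; exact hx p hp (by simpa using hd)
    | mul x y _ _ hx hy =>
      intro p hp hd
      exact (hp.dvd_mul.1 (hd.trans (Rat.mul_den_dvd x y))).elim (hx p hp) (hy p hp)
  · intro h
    have key : ∀ n : ℕ, n ≠ 0 → (∀ p : ℕ, p.Prime → p ∣ n → p ∈ S) →
        (n : ℚ)⁻¹ ∈ invertRing S := by
      intro n
      induction n using Nat.recOnMul with
      | zero => intro h; exact absurd rfl h
      | one => intro _ _; simp
      | prime p hp => intro _ h; exact Subring.subset_closure ⟨p, h p hp dvd_rfl, rfl⟩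
      | mul a b ha hb =>
        intro h0 h
        push_cast
        rw [mul_inv]
        exact (invertRing S).mul_mem
          (ha (left_ne_zero_of_mul h0) fun p hp hd => h p hp (hd.mul_right b))
          (hb (right_ne_zero_of_mul h0) fun p hp hd => h p hp (hd.mul_left a))
    rw [← Rat.num_div_den x, div_eq_mul_inv]
    exact (invertRing S).mul_mem (intCast_mem _ _) (key _ x.den_ne_zero h)

/-! ### Arithmetic on codes of polynomials -/

/-- Codes of integer polynomials: lists of codes of monomials. -/
abbrev PolyCode := List ((ℕ × ℕ) × List ℕ)

namespace PolyCode

/-- Coefficients are formal differences, multiplied by $(a-b)(c-d)=(ac+bd)-(ad+bc)$; exponent lists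
are padded with zeros to equal length. -/
def mulMonomial (s t : (ℕ × ℕ) × List ℕ) : (ℕ × ℕ) × List ℕ :=
  ((s.1.1 * t.1.1 + s.1.2 * t.1.2, s.1.1 * t.1.2 + s.1.2 * t.1.1),
    (List.range (max s.2.length t.2.length)).map fun i => s.2.getD i 0 + t.2.getD i 0)

def mul (l m : PolyCode) : PolyCode :=
  l.flatMap fun s => m.map (mulMonomial s)

/-- The constant polynomial `a - b`. -/
def const (a b : ℕ) : PolyCode := [((a, b), [])]

/-- The variable `X i`. -/
def var (i : ℕ) : PolyCode := [((1, 0), (List.range i).map (fun _ => 0) ++ [1])]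

def sq (l : PolyCode) : PolyCode := mul l l

def neg (l : PolyCode) : PolyCode := mul (const 0 1) l

/-- Turns a system of equations into one equation, as a sum of squares in $\mathbb{Q}$ vanishes only
if every term does. -/
def sumSq (L : List PolyCode) : PolyCode := L.flatMap sq

/-- A bound for the indices of the variables that occur in a polynomial. -/
def bound (l : PolyCode) : ℕ := (l.flatMap Prod.snd).length

noncomputable def eval (x : ℕ → ℚ) (l : PolyCode) : ℚ := MvPolynomial.aeval x (polyOfCode l)

theorem monomialOfCode_eq (t : (ℕ × ℕ) × List ℕ) {N : ℕ} (hN : t.2.length ≤ N) :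
    monomialOfCode t = MvPolynomial.C ((t.1.1 : ℤ) - t.1.2) *
      ∏ i ∈ Finset.range N, MvPolynomial.X i ^ t.2.getD i 0 := by
  rw [monomialOfCode]
  congr 1
  trans ∏ i ∈ Finset.range t.2.length, (MvPolynomial.X i : MvPolynomial ℕ ℤ) ^ t.2.getD i 0
  · rw [Finset.prod_range]
    refine Finset.prod_congr rfl fun i _ => ?_
    simp
  · refine Finset.prod_subset (Finset.range_subset_range.2 hN) fun i _ hi => ?_
    rw [Finset.mem_range, not_lt] at hi
    rw [List.getD_eq_default _ _ hi, pow_zero]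

theorem monomialOfCode_mulMonomial (s t : (ℕ × ℕ) × List ℕ) :
    monomialOfCode (mulMonomial s t) = monomialOfCode s * monomialOfCode t := by
  set N := max s.2.length t.2.length with hN
  rw [monomialOfCode_eq s (le_max_left _ _ : _ ≤ N), monomialOfCode_eq t (le_max_right _ _ : _ ≤ N),
    monomialOfCode_eq (mulMonomial s t) (N := N) (by simp [mulMonomial, hN])]
  rw [mul_mul_mul_comm, ← map_mul, ← Finset.prod_mul_distrib]
  congr 1
  · congr 1
    simp only [mulMonomial]
    push_cast
    ring
  · refine Finset.prod_congr rfl fun i hi => ?_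
    rw [← pow_add]
    congr 1
    rw [Finset.mem_range] at hi
    simp only [mulMonomial]
    rw [List.getD_eq_getElem _ _ (by simpa [hN] using hi)]
    simp

variable (x : ℕ → ℚ)

theorem eval_nil : eval x [] = 0 := by simp [eval, polyOfCode]

theorem eval_cons (t : (ℕ × ℕ) × List ℕ) (l : PolyCode) :
    eval x (t :: l) = MvPolynomial.aeval x (monomialOfCode t) + eval x l := by
  simp [eval, polyOfCode]

@[simp]
theorem eval_append (l m : PolyCode) : eval x (l ++ m) = eval x l + eval x m := by
  simp [eval, polyOfCode]

@[simp]
theorem eval_mul (l m : PolyCode) : eval x (mul l m) = eval x l * eval x m := by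
  have h1 : ∀ s, eval x (m.map (mulMonomial s)) =
      MvPolynomial.aeval x (monomialOfCode s) * eval x m := by
    intro s
    induction m with
    | nil => simp [eval_nil]
    | cons t m ih =>
      rw [List.map_cons, eval_cons, eval_cons, ih, monomialOfCode_mulMonomial, map_mul]
      ring
  induction l with
  | nil => simp [mul, eval_nil]
  | cons s l ih =>
    rw [mul, List.flatMap_cons, eval_append, h1, eval_cons, ← mul, ih]
    ring

@[simp]
theorem eval_const (a b : ℕ) : eval x (const a b) = a - b := by
  simp [eval, const, polyOfCode, monomialOfCode]

@[simp]
theorem eval_var (i : ℕ) : eval x (var i) = x i := by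
  rw [var, eval_cons, eval_nil, monomialOfCode_eq _ (N := i + 1) (by simp),
    Finset.prod_range_succ, Finset.prod_eq_one]
  · simp [List.getD]
  · intro j hj
    rw [Finset.mem_range] at hj
    rw [List.getD_append _ _ _ _ (by simpa using hj)]
    simp [List.getD, hj]

@[simp]
theorem eval_sq (l : PolyCode) : eval x (sq l) = eval x l ^ 2 := by
  rw [sq, eval_mul, pow_two]

@[simp]
theorem eval_neg (l : PolyCode) : eval x (neg l) = - eval x l := by
  simp [neg]

theorem eval_sumSq_eq_zero {L : List PolyCode} : eval x (sumSq L) = 0 ↔ ∀ l ∈ L, eval x l = 0 := by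
  have nonneg : ∀ L, 0 ≤ eval x (sumSq L) := by
    intro L
    induction L with
    | nil => simp [sumSq, eval_nil]
    | cons l L ih =>
      rw [sumSq, List.flatMap_cons, eval_append, eval_sq]
      exact add_nonneg (sq_nonneg _) ih
  induction L with
  | nil => simp [sumSq, eval_nil]
  | cons l L ih =>
    rw [sumSq, List.flatMap_cons, eval_append, eval_sq, ← sumSq,
      add_eq_zero_iff_of_nonneg (sq_nonneg _) (nonneg L)]
    simp [ih]

theorem eval_congr {x y : ℕ → ℚ} (l : PolyCode) (h : ∀ i < bound l, x i = y i) :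
    eval x l = eval y l := by
  induction l with
  | nil => simp [eval_nil]
  | cons t l ih =>
    have hb : bound (t :: l) = t.2.length + bound l := by simp [bound]
    rw [eval_cons, eval_cons, ih fun i hi => h i (by omega), monomialOfCode_eq t le_rfl]
    congr 1
    simp only [map_mul, map_prod, map_pow, MvPolynomial.aeval_X]
    congr 1
    · simp
    · refine Finset.prod_congr rfl fun i hi => ?_
      rw [Finset.mem_range] at hi
      rw [h i (by omega)]

theorem encode_mem_HTP (R : Subring ℚ) (l : PolyCode) :
    Encodable.encode l ∈ HTP R ↔ ∃ x : ℕ → ℚ, (∀ i, x i ∈ R) ∧ eval x l = 0 := by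
  have hp : polyOfIndex (Encodable.encode l) = polyOfCode l := by simp [polyOfIndex]
  have key : ∀ x : ℕ → R, ((MvPolynomial.aeval x (polyOfCode l) : R) : ℚ) =
      eval (fun i => (x i : ℚ)) l := by
    intro x
    exact MvPolynomial.comp_aeval_apply (φ := (R.subtype.toIntAlgHom)) x (polyOfCode l)
  simp only [HTP, Set.mem_ofPred_eq, hp]
  constructor
  · rintro ⟨x, hx⟩
    exact ⟨fun i => x i, fun i => (x i).2, by rw [← key, hx]; rfl⟩
  · rintro ⟨x, hx, h0⟩
    refine ⟨fun i => ⟨x i, hx i⟩, Subtype.ext ?_⟩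
    rw [key]
    exact h0

theorem mem_HTP (R : Subring ℚ) (e : ℕ) :
    e ∈ HTP R ↔ ∃ x : ℕ → ℚ, (∀ i, x i ∈ R) ∧ eval x (Denumerable.ofNat PolyCode e) = 0 := by
  conv_lhs => rw [← Denumerable.encode_ofNat (α := PolyCode) e]
  exact encode_mem_HTP R _

end PolyCode

namespace PolyCode

section Primrec

theorem primrec_mulMonomial : Primrec₂ mulMonomial := by
  have s1 : Primrec fun p : ((ℕ × ℕ) × List ℕ) × ((ℕ × ℕ) × List ℕ) => p.1.1.1 :=
    Primrec.fst.comp (Primrec.fst.comp Primrec.fst)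
  have s2 : Primrec fun p : ((ℕ × ℕ) × List ℕ) × ((ℕ × ℕ) × List ℕ) => p.1.1.2 :=
    Primrec.snd.comp (Primrec.fst.comp Primrec.fst)
  have t1 : Primrec fun p : ((ℕ × ℕ) × List ℕ) × ((ℕ × ℕ) × List ℕ) => p.2.1.1 :=
    Primrec.fst.comp (Primrec.fst.comp Primrec.snd)
  have t2 : Primrec fun p : ((ℕ × ℕ) × List ℕ) × ((ℕ × ℕ) × List ℕ) => p.2.1.2 :=
    Primrec.snd.comp (Primrec.fst.comp Primrec.snd)
  have sl : Primrec fun p : ((ℕ × ℕ) × List ℕ) × ((ℕ × ℕ) × List ℕ) => p.1.2 :=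
    Primrec.snd.comp Primrec.fst
  have tl : Primrec fun p : ((ℕ × ℕ) × List ℕ) × ((ℕ × ℕ) × List ℕ) => p.2.2 :=
    Primrec.snd.comp Primrec.snd
  refine Primrec.pair (Primrec.pair ?_ ?_) ?_
  · exact Primrec.nat_add.comp (Primrec.nat_mul.comp s1 t1) (Primrec.nat_mul.comp s2 t2)
  · exact Primrec.nat_add.comp (Primrec.nat_mul.comp s1 t2) (Primrec.nat_mul.comp s2 t1)
  · refine Primrec.list_map (Primrec.list_range.comp
      (Primrec.nat_max.comp (Primrec.list_length.comp sl) (Primrec.list_length.comp tl))) ?_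
    exact Primrec.nat_add.comp ((Primrec.list_getD 0).comp (sl.comp Primrec.fst) Primrec.snd)
      ((Primrec.list_getD 0).comp (tl.comp Primrec.fst) Primrec.snd)

theorem primrec_mul : Primrec₂ mul := by
  refine Primrec.list_flatMap Primrec.fst ?_
  refine Primrec.list_map (Primrec.snd.comp Primrec.fst) ?_
  exact primrec_mulMonomial.comp (Primrec.snd.comp Primrec.fst) Primrec.snd

theorem primrec_const : Primrec₂ const :=
  Primrec.list_cons.comp (Primrec.pair Primrec.id (Primrec.const [])) (Primrec.const [])

theorem primrec_var : Primrec var :=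
  Primrec.list_cons.comp (Primrec.pair (Primrec.const (1, 0))
    (Primrec.list_append.comp (Primrec.list_map Primrec.list_range (Primrec.const 0).to₂)
      (Primrec.const [1]))) (Primrec.const [])

theorem primrec_sq : Primrec sq := primrec_mul.comp Primrec.id Primrec.id

theorem primrec_neg : Primrec neg := primrec_mul.comp (Primrec.const (const 0 1)) Primrec.id

theorem primrec_sumSq : Primrec sumSq :=
  Primrec.list_flatMap Primrec.id (primrec_sq.comp Primrec.snd)

theorem primrec_bound : Primrec bound :=
  Primrec.list_length.comp (Primrec.list_flatMap Primrec.id (Primrec.snd.comp Primrec.snd))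

end Primrec

/-! ### Diophantine encoding of integral zeros and of given points -/

/-- The equation `X N = 1 + X (N + 1) ² + ⋯ + X (N + 4) ²` of a common positive denominator. -/
def denominatorEq (N : ℕ) : PolyCode :=
  neg (var N) ++ const 1 0 ++ sq (var (N + 1)) ++ sq (var (N + 2)) ++ sq (var (N + 3)) ++
    sq (var (N + 4))

/-- The offset skips the $N$ original variables and the five of `denominatorEq`; for $k<3$ different
triples $(i,j,k)$ get different indices. -/
def auxVar (N i j k : ℕ) : ℕ := N + 5 + (3 * Nat.pair i j + k)

/-- The equation `a² - r b² - p c² + p r x² d² = d²`, where `x` is the variable `X i`, `d` is the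
common denominator, and `a`, `b`, `c` are auxiliary variables. -/
def integralityEq (N i j : ℕ) (c : ℕ × ℕ) : PolyCode :=
  sq (var (auxVar N i j 0)) ++ mul (const 0 c.2) (sq (var (auxVar N i j 1))) ++
    mul (const 0 c.1) (sq (var (auxVar N i j 2))) ++
    mul (mul (const c.1 0) (const c.2 0)) (mul (sq (var i)) (sq (var N))) ++ neg (sq (var N))

/-- The equations that say that `X i`, for `i < N`, is integral at the pairs in the list `C`. -/
def integralitySystem (N : ℕ) (C : List (ℕ × ℕ)) : List PolyCode :=
  denominatorEq N :: (List.range N).flatMap fun i => (List.range C.length).map fun j =>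
    integralityEq N i j (C.getD j (0, 0))

/-- The index of a polynomial that has a zero if and only if the `e`-th polynomial has a zero whose
coordinates are integral at the pairs in the list `C`. -/
def integralZeroIndex (e : ℕ) (C : List (ℕ × ℕ)) : ℕ :=
  Encodable.encode (sumSq (Denumerable.ofNat PolyCode e ::
    integralitySystem (bound (Denumerable.ofNat PolyCode e)) C))

/-- The equations `D X i = u - v`, where `(u, v)` is the `i`-th entry of the list `a`. -/
def pointSystem (N D : ℕ) (a : List (ℕ × ℕ)) : List PolyCode :=
  (List.range N).map fun i => mul (const D 0) (var i) ++
    const (a.getD i (0, 0)).2 (a.getD i (0, 0)).1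

/-- The index of a polynomial that has a zero if and only if the `e`-th polynomial vanishes at the
point with the common denominator `D` and the numerators listed in `a`. -/
def pointIndex (e D : ℕ) (a : List (ℕ × ℕ)) : ℕ :=
  Encodable.encode (sumSq (Denumerable.ofNat PolyCode e ::
    pointSystem (bound (Denumerable.ofNat PolyCode e)) D a))

section Primrec

theorem primrec_append {α : Type*} [Primcodable α] {f g : α → PolyCode} (hf : Primrec f)
    (hg : Primrec g) : Primrec fun a => f a ++ g a := Primrec.list_append.comp hf hg

theorem primrec_add_const {α : Type*} [Primcodable α] {f : α → ℕ} (hf : Primrec f) (k : ℕ) :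
    Primrec fun a => f a + k := Primrec.nat_add.comp hf (Primrec.const k)

theorem primrec_denominatorEq : Primrec denominatorEq := by
  have h : ∀ k, Primrec fun N : ℕ => sq (var (N + k)) := fun k =>
    primrec_sq.comp (primrec_var.comp (primrec_add_const Primrec.id k))
  exact primrec_append (primrec_append (primrec_append (primrec_append (primrec_append
    (primrec_neg.comp primrec_var) (Primrec.const _)) (h 1)) (h 2)) (h 3)) (h 4)

theorem primrec_integralityEq :
    Primrec fun t : (ℕ × ℕ × ℕ) × (ℕ × ℕ) => integralityEq t.1.1 t.1.2.1 t.1.2.2 t.2 := by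
  have hN : Primrec fun t : (ℕ × ℕ × ℕ) × (ℕ × ℕ) => t.1.1 := Primrec.fst.comp Primrec.fst
  have hi : Primrec fun t : (ℕ × ℕ × ℕ) × (ℕ × ℕ) => t.1.2.1 :=
    Primrec.fst.comp (Primrec.snd.comp Primrec.fst)
  have hj : Primrec fun t : (ℕ × ℕ × ℕ) × (ℕ × ℕ) => t.1.2.2 :=
    Primrec.snd.comp (Primrec.snd.comp Primrec.fst)
  have hp : Primrec fun t : (ℕ × ℕ × ℕ) × (ℕ × ℕ) => t.2.1 := Primrec.fst.comp Primrec.snd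
  have hr : Primrec fun t : (ℕ × ℕ × ℕ) × (ℕ × ℕ) => t.2.2 := Primrec.snd.comp Primrec.snd
  have haux : ∀ k, Primrec fun t : (ℕ × ℕ × ℕ) × (ℕ × ℕ) =>
      sq (var (auxVar t.1.1 t.1.2.1 t.1.2.2 k)) := fun k =>
    primrec_sq.comp (primrec_var.comp (Primrec.nat_add.comp (primrec_add_const hN 5)
      (primrec_add_const (Primrec.nat_mul.comp (Primrec.const 3) (Primrec₂.natPair.comp hi hj)) k)))
  have hd : Primrec fun t : (ℕ × ℕ × ℕ) × (ℕ × ℕ) => sq (var t.1.1) :=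
    primrec_sq.comp (primrec_var.comp hN)
  refine primrec_append (primrec_append (primrec_append (primrec_append (haux 0) ?_) ?_) ?_) ?_
  · exact primrec_mul.comp (primrec_const.comp (Primrec.const 0) hr) (haux 1)
  · exact primrec_mul.comp (primrec_const.comp (Primrec.const 0) hp) (haux 2)
  · exact primrec_mul.comp (primrec_mul.comp (primrec_const.comp hp (Primrec.const 0))
      (primrec_const.comp hr (Primrec.const 0)))
      (primrec_mul.comp (primrec_sq.comp (primrec_var.comp hi)) hd)
  · exact primrec_neg.comp hd

theorem primrec_integralitySystem : Primrec₂ integralitySystem := by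
  have h : Primrec fun s : ((ℕ × List (ℕ × ℕ)) × ℕ) × ℕ =>
      ((s.1.1.1, s.1.2, s.2), s.1.1.2.getD s.2 (0, 0)) :=
    Primrec.pair (Primrec.pair (Primrec.fst.comp (Primrec.fst.comp Primrec.fst))
      (Primrec.pair (Primrec.snd.comp Primrec.fst) Primrec.snd))
      ((Primrec.list_getD (0, 0)).comp (Primrec.snd.comp (Primrec.fst.comp Primrec.fst))
        Primrec.snd)
  have h1 : Primrec₂ fun (s : (ℕ × List (ℕ × ℕ)) × ℕ) (j : ℕ) =>
      integralityEq s.1.1 s.2 j (s.1.2.getD j (0, 0)) := (primrec_integralityEq.comp h).to₂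
  have h2 : Primrec fun s : (ℕ × List (ℕ × ℕ)) × ℕ => List.range s.1.2.length :=
    Primrec.list_range.comp (Primrec.list_length.comp (Primrec.snd.comp Primrec.fst))
  have h3 : Primrec₂ fun (s : ℕ × List (ℕ × ℕ)) (i : ℕ) => (List.range s.2.length).map fun j =>
      integralityEq s.1 i j (s.2.getD j (0, 0)) := (Primrec.list_map h2 h1).to₂
  have h4 : Primrec fun s : ℕ × List (ℕ × ℕ) => List.range s.1 :=
    Primrec.list_range.comp Primrec.fst
  exact (Primrec.list_cons.comp (primrec_denominatorEq.comp Primrec.fst)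
    (Primrec.list_flatMap h4 h3)).to₂

theorem primrec_integralZeroIndex : Primrec₂ integralZeroIndex := by
  have h : Primrec fun t : ℕ × List (ℕ × ℕ) => Denumerable.ofNat PolyCode t.1 :=
    (Primrec.ofNat PolyCode).comp Primrec.fst
  have h1 := primrec_integralitySystem.comp (primrec_bound.comp h) Primrec.snd
  exact Primrec.encode.comp (primrec_sumSq.comp (Primrec.list_cons.comp h h1))

theorem primrec_pointSystem :
    Primrec fun t : (ℕ × ℕ) × List (ℕ × ℕ) => pointSystem t.1.1 t.1.2 t.2 := by
  refine Primrec.list_map (Primrec.list_range.comp (Primrec.fst.comp Primrec.fst)) ?_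
  have ha : Primrec fun t : ((ℕ × ℕ) × List (ℕ × ℕ)) × ℕ => t.1.2.getD t.2 (0, 0) :=
    (Primrec.list_getD (0, 0)).comp (Primrec.snd.comp Primrec.fst) Primrec.snd
  refine primrec_append (primrec_mul.comp (primrec_const.comp ?_ (Primrec.const 0))
    (primrec_var.comp Primrec.snd)) (primrec_const.comp (Primrec.snd.comp ha) (Primrec.fst.comp ha))
  exact Primrec.snd.comp (Primrec.fst.comp Primrec.fst)

theorem primrec_pointIndex :
    Primrec fun t : ℕ × ℕ × List (ℕ × ℕ) => pointIndex t.1 t.2.1 t.2.2 := by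
  have h : Primrec fun t : ℕ × ℕ × List (ℕ × ℕ) => Denumerable.ofNat PolyCode t.1 :=
    (Primrec.ofNat PolyCode).comp Primrec.fst
  have h1 := primrec_pointSystem.comp (Primrec.pair (Primrec.pair (primrec_bound.comp h)
      (Primrec.fst.comp Primrec.snd)) (Primrec.snd.comp Primrec.snd))
  exact Primrec.encode.comp (primrec_sumSq.comp (Primrec.list_cons.comp h h1))

end Primrec

theorem pointIndex_mem_HTP {R : Subring ℚ} {e D : ℕ} {a : List (ℕ × ℕ)} (hD : D ≠ 0) :
    pointIndex e D a ∈ HTP R ↔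
      (∀ i < bound (Denumerable.ofNat PolyCode e),
        (((a.getD i (0, 0)).1 : ℚ) - (a.getD i (0, 0)).2) / D ∈ R) ∧
      eval (fun i => (((a.getD i (0, 0)).1 : ℚ) - (a.getD i (0, 0)).2) / D)
        (Denumerable.ofNat PolyCode e) = 0 := by
  have hD' : (D : ℚ) ≠ 0 := by exact_mod_cast hD
  simp only [pointIndex, encode_mem_HTP, eval_sumSq_eq_zero, List.forall_mem_cons, pointSystem,
    List.forall_mem_map, List.mem_range, eval_append, eval_mul, eval_const, eval_var]
  set f := Denumerable.ofNat PolyCode e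
  have key : ∀ (x : ℚ) (i : ℕ), ((D : ℚ) - (0 : ℕ)) * x + (((a.getD i (0, 0)).2 : ℚ) -
      (a.getD i (0, 0)).1) = 0 ↔
      x = (((a.getD i (0, 0)).1 : ℚ) - (a.getD i (0, 0)).2) / D := by
    intro x i
    rw [eq_div_iff hD']
    constructor <;> intro h <;> push_cast at * <;> linarith
  simp only [key]
  constructor
  · rintro ⟨x, hx, h0, h1⟩
    refine ⟨fun i hi => h1 i hi ▸ hx i, ?_⟩
    rw [← h0]
    exact eval_congr f fun i hi => (h1 i hi).symm
  · rintro ⟨h1, h0⟩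
    refine ⟨fun i => if i < bound f then
      (((a.getD i (0, 0)).1 : ℚ) - (a.getD i (0, 0)).2) / D else 0, fun i => ?_, ?_, ?_⟩
    · dsimp only
      split_ifs with h
      · exact h1 i h
      · exact R.zero_mem
    · rw [← h0]
      exact eval_congr f fun i hi => by simp only [hi, if_true]
    · intro i hi
      simp only [hi, if_true]

theorem integralitySystem_iff {N : ℕ} {C : List (ℕ × ℕ)} {x : ℕ → ℚ} :
    (∀ l ∈ integralitySystem N C, eval x l = 0) ↔
      x N = 1 + x (N + 1) ^ 2 + x (N + 2) ^ 2 + x (N + 3) ^ 2 + x (N + 4) ^ 2 ∧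
      ∀ i < N, ∀ j < C.length, x (auxVar N i j 0) ^ 2
        - (C.getD j (0, 0)).2 * x (auxVar N i j 1) ^ 2
        - (C.getD j (0, 0)).1 * x (auxVar N i j 2) ^ 2
        + (C.getD j (0, 0)).1 * (C.getD j (0, 0)).2 * (x i ^ 2 * x N ^ 2) = x N ^ 2 := by
  simp only [integralitySystem, List.forall_mem_cons, List.mem_flatMap, List.mem_map,
    List.mem_range, denominatorEq, integralityEq, eval_append, eval_const, eval_var, eval_sq, eval_neg]
  refine and_congr ⟨fun h => by push_cast at h; linarith, fun h => by push_cast; linarith⟩ ?_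
  constructor
  · intro h i hi j hj
    have := h _ ⟨i, hi, j, hj, rfl⟩
    simp only [eval_append, eval_mul, eval_const, eval_var, eval_sq, eval_neg] at this
    push_cast at this
    linarith
  · rintro h _ ⟨i, hi, j, hj, rfl⟩
    have := h i hi j hj
    simp only [eval_append, eval_mul, eval_const, eval_var, eval_sq, eval_neg]
    push_cast
    linarith

theorem natCast_eq_sum_four_sq (n : ℕ) (hn : n ≠ 0) :
    ∃ s : Fin 4 → ℕ, (n : ℚ) = 1 + (s 0 : ℚ) ^ 2 + (s 1 : ℚ) ^ 2 + (s 2 : ℚ) ^ 2 + (s 3 : ℚ) ^ 2 := by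
  obtain ⟨m, rfl⟩ := Nat.exists_eq_succ_of_ne_zero hn
  obtain ⟨a, b, c, d, h⟩ := Nat.sum_four_squares m
  refine ⟨![a, b, c, d], ?_⟩
  have h' : (m : ℚ) = a ^ 2 + b ^ 2 + c ^ 2 + d ^ 2 := by exact_mod_cast h.symm
  simp
  linarith

/-- The auxiliary rationals supplied by `IsRamifiedPair.exists_iff` need not lie in $R$, so the
equations are multiplied by $d^2$. Requiring $d$ to be $1$ plus four squares keeps it nonzero, and
by Lagrange's theorem allows every positive integer $d$. -/
theorem integralZeroIndex_mem_HTP {R : Subring ℚ} {e : ℕ} {C : List (ℕ × ℕ)}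
    (hC : ∀ c ∈ C, IsRamifiedPair c) :
    integralZeroIndex e C ∈ HTP R ↔ ∃ x : ℕ → ℚ, (∀ i, x i ∈ R) ∧
      (∀ i, ∀ c ∈ C, ¬ c.1 ∣ (x i).den ∧ ¬ c.2 ∣ (x i).den) ∧
      eval x (Denumerable.ofNat PolyCode e) = 0 := by
  simp only [integralZeroIndex, encode_mem_HTP, eval_sumSq_eq_zero, List.forall_mem_cons,
    integralitySystem_iff]
  set f := Denumerable.ofNat PolyCode e
  set N := bound f
  constructor
  · rintro ⟨x, hx, h0, hd, h⟩
    -- The system constrains only the first $N$ variables; the others do not affect the value of $f$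
    -- and are reset to an integral value.
    refine ⟨fun i => if i < N then x i else 0, fun i => ?_, fun i c hc => ?_, ?_⟩
    · dsimp only
      split_ifs
      · exact hx i
      · exact R.zero_mem
    · dsimp only
      split_ifs with hi
      · obtain ⟨j, hj, hjc⟩ := List.getElem_of_mem hc
        have hij := h i hi j hj
        rw [List.getD_eq_getElem _ _ hj, hjc] at hij
        have hd0 : x N ≠ 0 := by
          have : 0 < x N := by rw [hd]; positivity
          exact this.ne'
        refine (IsRamifiedPair.exists_iff (p := c.1) (r := c.2) (hC _ hc) (x i)).1 ⟨x (auxVar N i j 0) / x N,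
          x (auxVar N i j 1) / x N, x (auxVar N i j 2) / x N, ?_⟩
        field_simp
        linarith
      · have := hC c hc
        simpa using ⟨this.1.ne_one, this.2.2.1.ne_one⟩
    · rw [← h0]
      exact eval_congr f fun i hi => by simp only [if_pos (show i < N from hi)]
  · rintro ⟨x, hx, hint, h0⟩
    have hex : ∀ i j : ℕ, ∃ u : ℕ → ℚ, j < C.length → u 0 ^ 2 - (C.getD j (0, 0)).2 * u 1 ^ 2
        - (C.getD j (0, 0)).1 * u 2 ^ 2 + (C.getD j (0, 0)).1 * (C.getD j (0, 0)).2 * x i ^ 2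
        = 1 := by
      intro i j
      by_cases hj : j < C.length
      · have hc : C.getD j (0, 0) ∈ C := by
          rw [List.getD_eq_getElem _ _ hj]; exact List.getElem_mem hj
        obtain ⟨a, b, c, h⟩ := (IsRamifiedPair.exists_iff (p := (C.getD j (0, 0)).1)
          (r := (C.getD j (0, 0)).2) (hC _ hc) (x i)).2 (hint i _ hc)
        exact ⟨fun k => if k = 0 then a else if k = 1 then b else c, fun _ => by simpa using h⟩
      · exact ⟨0, fun h => absurd h hj⟩
    choose u hu using hex
    let v : ℕ → ℚ := fun m => u (m / 3).unpair.1 (m / 3).unpair.2 (m % 3)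
    have hv : ∀ i j k, k < 3 → v (3 * Nat.pair i j + k) = u i j k := by
      intro i j k hk
      simp only [v]
      rw [show (3 * Nat.pair i j + k) / 3 = Nat.pair i j by omega,
        show (3 * Nat.pair i j + k) % 3 = k by omega, Nat.unpair_pair]
    -- By monotonicity of the pairing this exceeds every slot $3\langle i,j\rangle+k$ in use, so a
    -- finite product $D$ clears all relevant denominators.
    let B := 3 * Nat.pair N C.length
    let D := ∏ m ∈ Finset.range B, (v m).den
    have hD0 : D ≠ 0 := Finset.prod_ne_zero_iff.2 fun m _ => (v m).den_ne_zero
    have hvD : ∀ m < B, v m * D ∈ R := by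
      intro m hm
      obtain ⟨q, hq⟩ : (v m).den ∣ D := Finset.dvd_prod_of_mem _ (Finset.mem_range.2 hm)
      rw [hq]
      push_cast
      rw [← mul_assoc, Rat.mul_den_eq_num]
      exact R.mul_mem (intCast_mem _ _) (natCast_mem _ _)
    obtain ⟨s, hs⟩ := natCast_eq_sum_four_sq D hD0
    let y : ℕ → ℚ := fun n => if n < N then x n else if n = N then D else if n = N + 1 then s 0
      else if n = N + 2 then s 1 else if n = N + 3 then s 2 else if n = N + 4 then s 3
      else if n - (N + 5) < B then v (n - (N + 5)) * D else 0
    have hyN : y N = D := by simp [y]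
    have haux : ∀ i < N, ∀ j < C.length, ∀ k < 3, y (auxVar N i j k) = u i j k * D := by
      intro i hi j hj k hk
      have hlt : 3 * Nat.pair i j + k < B := by
        have : Nat.pair i j < Nat.pair N C.length :=
          (Nat.pair_lt_pair_left j hi).trans (Nat.pair_lt_pair_right N hj)
        simp only [B]
        omega
      simp only [y, auxVar]
      rw [if_neg (by omega), if_neg (by omega), if_neg (by omega), if_neg (by omega),
        if_neg (by omega), if_neg (by omega), Nat.add_sub_cancel_left, if_pos hlt, hv i j k hk]
    refine ⟨y, fun n => ?_, ?_, ?_, fun i hi j hj => ?_⟩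
    · simp only [y]
      split_ifs with h1 h2 h3 h4 h5 h6 h7
      · exact hx n
      · exact natCast_mem _ _
      · exact natCast_mem _ _
      · exact natCast_mem _ _
      · exact natCast_mem _ _
      · exact natCast_mem _ _
      · exact hvD _ h7
      · exact R.zero_mem
    · rw [← h0]
      exact eval_congr f fun i hi => by simp only [y, if_pos (show i < N from hi)]
    · simpa [y] using hs
    · rw [haux i hi j hj 0 (by omega), haux i hi j hj 1 (by omega), haux i hi j hj 2 (by omega),
        hyN, show y i = x i by simp only [y, if_pos hi]]
      linear_combination (D : ℚ) ^ 2 * hu i j hj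

end PolyCode

/-! ### Iterated search relative to an oracle -/

section Oracle

theorem Nat.RecursiveIn.comp_tot {O : Set (ℕ →. ℕ)} {f g : ℕ → ℕ} (hf : Nat.RecursiveIn O f)
    (hg : Nat.RecursiveIn O g) : Nat.RecursiveIn O (fun n => f (g n) : ℕ → ℕ) :=
  (hf.comp hg).of_eq_tot fun _ => 
    Part.mem_bind_iff.2 ⟨_, Part.mem_some _, Part.mem_some _⟩

theorem Nat.RecursiveIn.pair_tot {O : Set (ℕ →. ℕ)} {f g : ℕ → ℕ} (hf : Nat.RecursiveIn O f)
    (hg : Nat.RecursiveIn O g) : Nat.RecursiveIn O (fun n => Nat.pair (f n) (g n) : ℕ → ℕ) :=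
  (hf.pair hg).of_eq_tot fun n => by simp [Seq.seq]

theorem Computable.nat_recursiveIn {O : Set (ℕ →. ℕ)} {f : ℕ → ℕ} (hf : Computable f) :
    Nat.RecursiveIn O f :=
  Nat.Partrec.recursiveIn (Partrec.nat_iff.1 hf)

/-- A search with an oracle for `B`, iterated: if every stage of the construction that satisfies
the invariant has a witness, then the answers of the oracle to the questions `Q₁` asked at the
stages are computable with the oracle. -/
theorem exists_stages_turingReducible {σ ω : Type} [Primcodable σ] [Inhabited σ] [Primcodable ω]
    [Inhabited ω] (B : Set ℕ) (s₀ : σ) {T : ℕ → σ → ω → Bool} {Q₁ : ℕ → σ → ℕ}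
    {Q₂ : ℕ → σ → ω → ℕ} {U : σ → ω → σ}
    (hT : Computable fun t : (ℕ × σ) × ω => T t.1.1 t.1.2 t.2)
    (hQ₁ : Computable₂ Q₁) (hQ₂ : Computable fun t : (ℕ × σ) × ω => Q₂ t.1.1 t.1.2 t.2)
    (hU : Computable₂ U) (P : ℕ → σ → Prop) (h0 : P 0 s₀)
    (hex : ∀ n s, P n s → ∃ w, T n s w = true ∧ (Q₁ n s ∈ B → Q₂ n s w ∈ B))
    (hsucc : ∀ n s w, P n s → T n s w = true → (Q₁ n s ∈ B → Q₂ n s w ∈ B) → P (n + 1) (U s w)) :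
    ∃ st : ℕ → σ, st 0 = s₀ ∧ (∀ n, P n (st n)) ∧
      (∀ n, ∃ w, T n (st n) w = true ∧ (Q₁ n (st n) ∈ B → Q₂ n (st n) w ∈ B) ∧
        st (n + 1) = U (st n) w) ∧
      SetTuringReducible {n | Q₁ n (st n) ∈ B} B := by
  classical
  set χ : ℕ → ℕ := fun n => if n ∈ B then 1 else 0 with hχ
  have hχB : charFun B = (χ : ℕ →. ℕ) := by
    funext n
    simp only [charFun, hχ, PFun.coe_val]
  let O : Set (ℕ →. ℕ) := {charFun B}
  have oχ : Nat.RecursiveIn O χ := .oracle _ (by rw [← hχB]; rfl)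
  let ds : ℕ → σ := fun n => (Encodable.decode n).getD default
  let dw : ℕ → ω := fun n => (Encodable.decode n).getD default
  have cds : Computable ds := Computable.option_getD Computable.decode (Computable.const _)
  have cdw : Computable dw := Computable.option_getD Computable.decode (Computable.const _)
  have ds_encode : ∀ s, ds (Encodable.encode s) = s := fun s => by simp [ds]
  have dw_encode : ∀ w, dw (Encodable.encode w) = w := fun s => by simp [dw]
  -- a number codes a stage, a state, and a witness
  let dec : ℕ → (ℕ × σ) × ω := fun x => ((x.unpair.1.unpair.1, ds x.unpair.1.unpair.2),
    dw x.unpair.2)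
  have c1 : Computable fun x : ℕ => x.unpair.1 := Computable.fst.comp Computable.unpair
  have c2 : Computable fun x : ℕ => x.unpair.2 := Computable.snd.comp Computable.unpair
  have cdec : Computable dec := Computable.pair (Computable.pair (c1.comp c1)
    (cds.comp (c2.comp c1))) (cdw.comp c2)
  let q1 : ℕ → ℕ := fun x => Q₁ (dec x).1.1 (dec x).1.2
  let q2 : ℕ → ℕ := fun x => Q₂ (dec x).1.1 (dec x).1.2 (dec x).2
  have cq1 : Computable q1 := hQ₁.comp (Computable.fst.comp (Computable.fst.comp cdec))
    (Computable.snd.comp (Computable.fst.comp cdec))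
  have cq2 : Computable q2 := hQ₂.comp cdec
  -- The argument codes a candidate together with the two oracle answers; the value $0$ means that
  -- the test holds and that the first answer is no or the second is yes.
  let H : ℕ → ℕ := fun y => bif (T (dec y.unpair.1).1.1 (dec y.unpair.1).1.2 (dec y.unpair.1).2
    && (decide (y.unpair.2.unpair.1 = 0) || decide (y.unpair.2.unpair.2 = 1))) then 0 else 1
  have cH : Computable H := by
    refine Computable.cond ?_ (Computable.const 0) (Computable.const 1)
    refine Primrec.and.to_comp.comp (hT.comp (cdec.comp c1)) (Primrec.or.to_comp.comp ?_ ?_)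
    · exact (Primrec.eq.decide.to_comp.comp (c1.comp c2) (Computable.const 0))
    · exact (Primrec.eq.decide.to_comp.comp (c2.comp c2) (Computable.const 1))
  let F : ℕ → ℕ := fun x => H (Nat.pair x (Nat.pair (χ (q1 x)) (χ (q2 x))))
  have oF : Nat.RecursiveIn O F := by
    refine Nat.RecursiveIn.comp_tot cH.nat_recursiveIn ?_
    refine Nat.RecursiveIn.pair_tot Computable.id.nat_recursiveIn ?_
    exact Nat.RecursiveIn.pair_tot (oχ.comp_tot cq1.nat_recursiveIn)
      (oχ.comp_tot cq2.nat_recursiveIn)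
  have hF : ∀ n s w, F (Nat.pair (Nat.pair n (Encodable.encode s)) w) = 0 ↔
      T n s (dw w) = true ∧ (Q₁ n s ∈ B → Q₂ n s (dw w) ∈ B) := by
    intro n s w
    simp only [F, H, q1, q2, dec, Nat.unpair_pair, ds_encode, hχ]
    cases T n s (dw w) <;> by_cases hb1 : Q₁ n s ∈ B <;> by_cases hb2 : Q₂ n s (dw w) ∈ B <;>
      simp [hb1, hb2]
  let find : ℕ →. ℕ := fun a => Nat.rfind fun w => (fun m => m = 0) <$> (F : ℕ →. ℕ) (Nat.pair a w)
  have ofind : Nat.RecursiveIn O find := .rfind oF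
  let upd : ℕ → ℕ := fun x => Encodable.encode (U (dec x).1.2 (dec x).2)
  have cupd : Computable upd := Computable.encode.comp
    (hU.comp (Computable.snd.comp (Computable.fst.comp cdec)) (Computable.snd.comp cdec))
  let step : ℕ →. ℕ := fun a => (Nat.pair <$> Part.some a <*> find a) >>= (upd : ℕ →. ℕ)
  have ostep : Nat.RecursiveIn O step :=
    (cupd.nat_recursiveIn).comp (Nat.RecursiveIn.pair Computable.id.nat_recursiveIn ofind)
  have hstep : ∀ n s, P n s → ∃ w, T n s w = true ∧ (Q₁ n s ∈ B → Q₂ n s w ∈ B) ∧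
      Encodable.encode (U s w) ∈ step (Nat.pair n (Encodable.encode s)) := by
    intro n s hs
    obtain ⟨w, hw⟩ := hex n s hs
    have hdom : (find (Nat.pair n (Encodable.encode s))).Dom := by
      refine Nat.rfind_dom.2 ⟨Encodable.encode w, ?_, fun _ => trivial⟩
      have := (hF n s (Encodable.encode w)).2 (by rwa [dw_encode])
      simpa using this
    obtain ⟨m, hm⟩ := Part.dom_iff_mem.1 hdom
    have h1 := Nat.rfind_spec hm
    have h2 : F (Nat.pair (Nat.pair n (Encodable.encode s)) m) = 0 := by simpa using h1
    have h3 := (hF n s m).1 h2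
    refine ⟨dw m, h3.1, h3.2, ?_⟩
    simp only [step]
    refine Part.mem_bind_iff.2 ⟨Nat.pair (Nat.pair n (Encodable.encode s)) m, ?_, ?_⟩
    · simpa [Seq.seq] using hm
    · simp [upd, dec, ds_encode]
  -- A partial recursion: the search is known to halt only at states satisfying $P$, and `hrun`
  -- shows that the run stays among these.
  let run : ℕ →. ℕ := fun n => n.rec (Part.some (Encodable.encode s₀)) fun y IH => do
    let i ← IH
    step (Nat.pair y i)
  have orun : Nat.RecursiveIn O run := by
    have h1 := Nat.RecursiveIn.prec (O := O)
      (Computable.const (Encodable.encode s₀)).nat_recursiveIn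
      (Nat.RecursiveIn.comp ostep c2.nat_recursiveIn)
    have h2 : Nat.RecursiveIn O (fun n => Nat.pair 0 n : ℕ → ℕ) :=
      Nat.RecursiveIn.pair_tot (Computable.const 0).nat_recursiveIn Computable.id.nat_recursiveIn
    refine (h1.comp h2).of_eq fun n => ?_
    simp only [PFun.coe_val, Part.bind_eq_bind, Part.bind_some, Nat.unpair_pair, run]
    congr 1
    funext y IH
    exact congrArg IH.bind (funext fun i => Part.bind_some _ _)
  have hrun : ∀ n, ∃ s, Encodable.encode s ∈ run n ∧ P n s := by
    intro n
    induction n with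
    | zero => exact ⟨s₀, Part.mem_some _, h0⟩
    | succ n ih =>
      obtain ⟨s, hs, hP⟩ := ih
      obtain ⟨w, hw1, hw2, hw3⟩ := hstep n s hP
      exact ⟨U s w, Part.mem_bind_iff.2 ⟨_, hs, hw3⟩, hsucc n s w hP hw1 hw2⟩
  choose st hst hPst using hrun
  refine ⟨st, ?_, hPst, ?_, ?_⟩
  · exact Encodable.encode_injective (Part.mem_unique (hst 0) (Part.mem_some _))
  · intro n
    obtain ⟨w, hw1, hw2, hw3⟩ := hstep n (st n) (hPst n)
    exact ⟨w, hw1, hw2, Encodable.encode_injective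
      (Part.mem_unique (hst (n + 1)) (Part.mem_bind_iff.2 ⟨_, hst n, hw3⟩))⟩
  · have ost : Nat.RecursiveIn O (fun n => Encodable.encode (st n) : ℕ → ℕ) :=
      orun.of_eq_tot hst
    have cq : Computable fun a : ℕ => Q₁ a.unpair.1 (ds a.unpair.2) :=
      hQ₁.comp c1 (cds.comp c2)
    have h1 : Nat.RecursiveIn O (fun n => χ (Q₁ n (st n)) : ℕ → ℕ) := by
      refine (oχ.comp_tot (cq.nat_recursiveIn.comp_tot
        (Nat.RecursiveIn.pair_tot Computable.id.nat_recursiveIn ost))).of_eq fun n => ?_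
      simp [ds_encode]
    refine RecursiveIn.iff_nat.2 (h1.of_eq fun n => ?_)
    simp only [charFun, hχ, PFun.coe_val, Set.mem_ofPred_eq]

end Oracle

/-! ### Decidability of the conditions on witnesses -/

section Primrec

theorem primrecRel_dvd : PrimrecRel fun a b : ℕ => a ∣ b :=
  PrimrecRel.of_eq (Primrec.eq.comp₂ (Primrec.nat_mod.comp₂ Primrec₂.right Primrec₂.left)
    (Primrec₂.const 0)) fun _ _ => (Nat.dvd_iff_mod_eq_zero).symm

theorem PrimrecRel.forall_lt_right {α : Type*} [Primcodable α] {R : ℕ → α → Prop}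
    (hR : PrimrecRel R) : PrimrecRel fun n a => ∀ x < n, R x a :=
  (hR.forall_mem_list.comp (Primrec.list_range.comp Primrec.fst) Primrec.snd).of_eq (by simp)

theorem primrecPred_prime : PrimrecPred Nat.Prime := by
  have h1 : PrimrecRel fun m p : ℕ => m ∣ p → m = 1 := by
    refine PrimrecRel.of_eq (r := fun m p : ℕ => ¬ m ∣ p ∨ m = 1) ?_ ?_
    · exact (PrimrecPred.not primrecRel_dvd).or
        (Primrec.eq.comp Primrec.fst (Primrec.const 1))
    · intro a b
      exact (imp_iff_not_or).symm
  have h2 : PrimrecPred fun p : ℕ => 2 ≤ p ∧ ∀ m < p, m ∣ p → m = 1 :=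
    (Primrec.nat_le.comp (Primrec.const 2) Primrec.id).and
      ((PrimrecRel.forall_lt h1).comp Primrec.id Primrec.id)
  exact h2.of_eq fun p => Nat.prime_def_lt.symm

theorem primrecPred_isRamifiedPair : PrimrecPred IsRamifiedPair := by
  have h1 : PrimrecRel fun (x : ℕ) (c : ℕ × ℕ) => x * x % c.1 ≠ c.2 % c.1 :=
    PrimrecPred.not (Primrec.eq.comp
      (Primrec.nat_mod.comp (Primrec.nat_mul.comp Primrec.fst Primrec.fst)
        (Primrec.fst.comp Primrec.snd))
      (Primrec.nat_mod.comp (Primrec.snd.comp Primrec.snd) (Primrec.fst.comp Primrec.snd)))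
  exact (primrecPred_prime.comp Primrec.fst).and <|
    (PrimrecPred.not (Primrec.eq.comp Primrec.fst (Primrec.const 2))).and <|
    (primrecPred_prime.comp Primrec.snd).and <|
    (Primrec.eq.comp (Primrec.nat_mod.comp Primrec.snd (Primrec.const 4)) (Primrec.const 1)).and <|
    (PrimrecRel.forall_lt_right h1).comp Primrec.fst Primrec.id

/-- No prime of the pair `c` divides `D`. -/
def CoprimePair (c : ℕ × ℕ) (D : ℕ) : Prop := ¬ c.1 ∣ D ∧ ¬ c.2 ∣ D

theorem primrecRel_coprimePair : PrimrecRel CoprimePair :=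
  (PrimrecPred.not (primrecRel_dvd.comp (Primrec.fst.comp Primrec.fst) Primrec.snd)).and
    (PrimrecPred.not (primrecRel_dvd.comp (Primrec.snd.comp Primrec.fst) Primrec.snd))

/-- Every prime divisor of `D` is in the list `L`. -/
def PrimeFactorsIn (D : ℕ) (L : List ℕ) : Prop := ∀ x < D + 1, ¬ x.Prime ∨ ¬ x ∣ D ∨ x ∈ L

theorem primrecRel_mem {α : Type*} [Primcodable α] [DecidableEq α] :
    PrimrecRel fun (a : α) (L : List α) => a ∈ L :=
  PrimrecPred.of_eq
    ((PrimrecRel.exists_mem_list (Primrec.eq (α := α))).comp Primrec.snd Primrec.fst) (by simp)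

theorem primrecRel_primeFactorsIn : PrimrecRel PrimeFactorsIn := by
  have h : PrimrecRel fun (x : ℕ) (t : ℕ × List ℕ) => ¬ x.Prime ∨ ¬ x ∣ t.1 ∨ x ∈ t.2 :=
    (PrimrecPred.not (primrecPred_prime.comp Primrec.fst)).or <|
    (PrimrecPred.not (primrecRel_dvd.comp Primrec.fst (Primrec.fst.comp Primrec.snd))).or <|
    primrecRel_mem.comp Primrec.fst (Primrec.snd.comp Primrec.snd)
  exact (PrimrecRel.forall_lt_right h).comp (Primrec.succ.comp Primrec.fst) Primrec.id

/-- Every entry of `L` divides `K`, or is `2`, or is the first component of a pair in `C`. -/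
def Excluded (L : List ℕ) (K : ℕ) (C : List (ℕ × ℕ)) : Prop :=
  ∀ p ∈ L, p ∣ K ∨ p = 2 ∨ ∃ c ∈ C, c.1 = p

theorem primrecPred_excluded :
    PrimrecPred fun t : List ℕ × ℕ × List (ℕ × ℕ) => Excluded t.1 t.2.1 t.2.2 := by
  have h1 : PrimrecRel fun (C : List (ℕ × ℕ)) (p : ℕ) => ∃ c ∈ C, c.1 = p :=
    PrimrecRel.exists_mem_list (R := fun (c : ℕ × ℕ) (p : ℕ) => c.1 = p)
      (Primrec.eq.comp (Primrec.fst.comp Primrec.fst) Primrec.snd)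
  have h : PrimrecRel fun (p : ℕ) (t : ℕ × List (ℕ × ℕ)) =>
      p ∣ t.1 ∨ p = 2 ∨ ∃ c ∈ t.2, c.1 = p :=
    (primrecRel_dvd.comp Primrec.fst (Primrec.fst.comp Primrec.snd)).or <|
    (Primrec.eq.comp Primrec.fst (Primrec.const 2)).or <|
    h1.comp (Primrec.snd.comp Primrec.snd) Primrec.fst
  exact (PrimrecRel.forall_mem_list h).comp Primrec.fst Primrec.snd

end Primrec

/-! ### The stages of the construction -/

/-- The first `n` values of `q`. -/
def firstValues (q : ℕ → ℕ) (n : ℕ) : List ℕ :=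
  n.rec [] fun y IH => IH ++ [q y]

theorem mem_firstValues {q : ℕ → ℕ} {n p : ℕ} : p ∈ firstValues q n ↔ ∃ j < n, q j = p := by
  induction n with
  | zero => simp [firstValues]
  | succ n ih =>
    rw [show firstValues q (n + 1) = firstValues q n ++ [q n] from rfl, List.mem_append, ih]
    simp only [List.mem_singleton]
    constructor
    · rintro (⟨j, hj, rfl⟩ | rfl)
      · exact ⟨j, by omega, rfl⟩
      · exact ⟨n, by omega, rfl⟩
    · rintro ⟨j, hj, rfl⟩
      rcases Nat.lt_succ_iff_lt_or_eq.1 hj with h | rfl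
      · exact Or.inl ⟨j, h, rfl⟩
      · exact Or.inr rfl

theorem computable_firstValues {q : ℕ → ℕ} (hq : Computable q) : Computable (firstValues q) := by
  refine Computable.nat_rec (f := fun n : ℕ => n) (g := fun _ : ℕ => ([] : List ℕ))
    (h := fun _ t => t.2 ++ [q t.1]) Computable.id (Computable.const []) ?_
  exact Computable.list_concat.comp (Computable.snd.comp Computable.snd)
    (hq.comp (Computable.fst.comp Computable.snd))

/-- The state of the construction: the pairs at which everything has to be integral, and a number
whose prime factors have been put into `S`. -/
abbrev State := List (ℕ × ℕ) × ℕ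

/-- What has to be found at a stage: a denominator, a number of values of `q` among which are its
prime factors, the numerators of a zero, and the new pairs. -/
abbrev Witness := (ℕ × ℕ) × List (ℕ × ℕ) × List (ℕ × ℕ)

namespace State

/-- Membership in $W$ is only semidecidable, so the witness carries a bound `w.1.2` up to which the
enumeration is inspected; this makes the condition decidable. The length $(KD+1)(n+1)$ in the last
clause is what yields the density estimate. -/
def Admissible (q : ℕ → ℕ) (n : ℕ) (s : State) (w : Witness) : Prop :=
  w.1.1 ≠ 0 ∧ PrimeFactorsIn w.1.1 (firstValues q w.1.2) ∧ (∀ c ∈ s.1, CoprimePair c w.1.1) ∧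
    (∀ c ∈ w.2.2, IsRamifiedPair c) ∧ (∀ c ∈ w.2.2, CoprimePair c (s.2 * w.1.1)) ∧
    Excluded (firstValues q ((s.2 * w.1.1 + 1) * (n + 1))) (s.2 * w.1.1) w.2.2

def update (s : State) (w : Witness) : State := (s.1 ++ w.2.2, s.2 * w.1.1)

theorem computable_update : Computable₂ update := by
  have h1 : Primrec fun t : State × Witness => t.1.1 ++ t.2.2.2 :=
    Primrec.list_append.comp (Primrec.fst.comp Primrec.fst)
      (Primrec.snd.comp (Primrec.snd.comp Primrec.snd))
  have h2 : Primrec fun t : State × Witness => t.1.2 := Primrec.snd.comp Primrec.fst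
  have h3 : Primrec fun t : State × Witness => t.2.1.1 :=
    Primrec.fst.comp (Primrec.fst.comp Primrec.snd)
  have h4 : Primrec fun t : State × Witness => t.1.2 * t.2.1.1 := Primrec.nat_mul.comp h2 h3
  have h5 : Primrec fun t : State × Witness => update t.1 t.2 := h1.pair h4
  exact Computable₂.mk h5.to_comp

-- As `q` is merely computable, the two lists of its values are computed first and then passed to a
-- primitive recursive predicate.
open Classical in
theorem computable_admissible {q : ℕ → ℕ} (hq : Computable q) :
    Computable fun t : (ℕ × State) × Witness => decide (Admissible q t.1.1 t.1.2 t.2) := by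
  let A := (State × Witness) × (List ℕ × List ℕ)
  have hC : Primrec fun a : A => a.1.1.1 := Primrec.fst.comp (Primrec.fst.comp Primrec.fst)
  have hK : Primrec fun a : A => a.1.1.2 := Primrec.snd.comp (Primrec.fst.comp Primrec.fst)
  have hD : Primrec fun a : A => a.1.2.1.1 :=
    Primrec.fst.comp (Primrec.fst.comp (Primrec.snd.comp Primrec.fst))
  have hC' : Primrec fun a : A => a.1.2.2.2 :=
    Primrec.snd.comp (Primrec.snd.comp (Primrec.snd.comp Primrec.fst))
  have hKD : Primrec fun a : A => a.1.1.2 * a.1.2.1.1 := Primrec.nat_mul.comp hK hD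
  have hp : PrimrecPred fun a : A => a.1.2.1.1 ≠ 0 ∧ PrimeFactorsIn a.1.2.1.1 a.2.1 ∧
      (∀ c ∈ a.1.1.1, CoprimePair c a.1.2.1.1) ∧ (∀ c ∈ a.1.2.2.2, IsRamifiedPair c) ∧
      (∀ c ∈ a.1.2.2.2, CoprimePair c (a.1.1.2 * a.1.2.1.1)) ∧
      Excluded a.2.2 (a.1.1.2 * a.1.2.1.1) a.1.2.2.2 :=
    (PrimrecPred.not (Primrec.eq.comp hD (Primrec.const 0))).and <|
    (primrecRel_primeFactorsIn.comp hD (Primrec.fst.comp Primrec.snd)).and <|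
    ((PrimrecRel.forall_mem_list primrecRel_coprimePair).comp hC hD).and <|
    ((PrimrecPred.forall_mem_list primrecPred_isRamifiedPair).comp hC').and <|
    ((PrimrecRel.forall_mem_list primrecRel_coprimePair).comp hC' hKD).and <|
    primrecPred_excluded.comp (Primrec.pair (Primrec.snd.comp Primrec.snd)
      (Primrec.pair hKD hC'))
  have hp' := (primrecPred_iff_primrec_decide.1 hp).to_comp
  have hs : Computable fun t : (ℕ × State) × Witness => t.1.2 :=
    Computable.snd.comp Computable.fst
  have hk : Computable fun t : (ℕ × State) × Witness => t.2.1.2 :=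
    Computable.snd.comp (Computable.fst.comp Computable.snd)
  have hm : Primrec fun t : (ℕ × State) × Witness => (t.1.2.2 * t.2.1.1 + 1) * (t.1.1 + 1) := by
    have h1 : Primrec fun t : (ℕ × State) × Witness => t.1.2.2 :=
      Primrec.snd.comp (Primrec.snd.comp Primrec.fst)
    have h2 : Primrec fun t : (ℕ × State) × Witness => t.2.1.1 :=
      Primrec.fst.comp (Primrec.fst.comp Primrec.snd)
    have h3 : Primrec fun t : (ℕ × State) × Witness => t.1.2.2 * t.2.1.1 + 1 :=
      Primrec.succ.comp (Primrec.nat_mul.comp h1 h2)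
    have h4 : Primrec fun t : (ℕ × State) × Witness => t.1.1 + 1 :=
      Primrec.succ.comp (Primrec.fst.comp Primrec.fst)
    exact Primrec.nat_mul.comp h3 h4
  have hin : Computable fun t : (ℕ × State) × Witness => (((t.1.2, t.2), (firstValues q t.2.1.2,
      firstValues q ((t.1.2.2 * t.2.1.1 + 1) * (t.1.1 + 1)))) : A) :=
    Computable.pair (Computable.pair hs Computable.snd)
      (Computable.pair ((computable_firstValues hq).comp hk)
        ((computable_firstValues hq).comp hm.to_comp))
  exact (hp'.comp hin).of_eq fun t => decide_eq_decide.2 Iff.rfl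

end State

theorem PrimeFactorsIn.mem {D p : ℕ} {L : List ℕ} (h : PrimeFactorsIn D L) (hD : D ≠ 0)
    (hp : p.Prime) (hd : p ∣ D) : p ∈ L := by
  rcases h p (Nat.lt_succ_of_le (Nat.le_of_dvd (Nat.pos_of_ne_zero hD) hd)) with h | h | h
  · exact absurd hp h
  · exact absurd hd h
  · exact h

theorem CoprimePair.mul {c : ℕ × ℕ} (hc : IsRamifiedPair c) {a b : ℕ} (ha : CoprimePair c a)
    (hb : CoprimePair c b) : CoprimePair c (a * b) :=
  ⟨fun h => (hc.1.dvd_mul.1 h).elim ha.1 hb.1, fun h => (hc.2.2.1.dvd_mul.1 h).elim ha.2 hb.2⟩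

namespace State

/-- The properties that every stage of the construction preserves. -/
structure Valid (W : Set ℕ) (s : State) : Prop where
  pair : ∀ c ∈ s.1, IsRamifiedPair c
  coprime : ∀ c ∈ s.1, CoprimePair c s.2
  ne_zero : s.2 ≠ 0
  mem : ∀ p : ℕ, p.Prime → p ∣ s.2 → p ∈ W

variable {W : Set ℕ} {q : ℕ → ℕ}

theorem Valid.update {n : ℕ} {s : State} {w : Witness} (hq : ∀ j, q j ∈ W) (hs : Valid W s)
    (hw : Admissible q n s w) : Valid W (update s w) := by
  obtain ⟨hD, hfac, hcop, hram, hcop', -⟩ := hw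
  refine ⟨?_, ?_, mul_ne_zero hs.ne_zero hD, ?_⟩
  · intro c hc
    exact (List.mem_append.1 hc).elim (hs.pair c) (hram c)
  · intro c hc
    rcases List.mem_append.1 hc with h | h
    · exact CoprimePair.mul (hs.pair c h) (hs.coprime c h) (hcop c h)
    · exact hcop' c h
  · intro p hp hd
    rcases hp.dvd_mul.1 hd with h | h
    · exact hs.mem p hp h
    · obtain ⟨j, -, rfl⟩ := mem_firstValues.1 (PrimeFactorsIn.mem hfac hD hp h)
      exact hq j

theorem exists_firstValues (hqr : Set.range q = W) {D : ℕ} (hDW : ∀ p : ℕ, p.Prime → p ∣ D → p ∈ W) :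
    ∃ k, PrimeFactorsIn D (firstValues q k) := by
  have h : ∀ p : ℕ, ∃ j, p.Prime → p ∣ D → q j = p := by
    intro p
    by_cases hp : p.Prime ∧ p ∣ D
    · obtain ⟨j, hj⟩ : p ∈ Set.range q := hqr ▸ hDW p hp.1 hp.2
      exact ⟨j, fun _ _ => hj⟩
    · exact ⟨0, fun h1 h2 => absurd ⟨h1, h2⟩ hp⟩
  choose j hj using h
  refine ⟨(Finset.range (D + 1)).sup j + 1, fun x hx => ?_⟩
  by_cases h1 : x.Prime
  · by_cases h2 : x ∣ D
    · exact Or.inr (Or.inr (mem_firstValues.2 ⟨j x, Nat.lt_succ_of_le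
        (Finset.le_sup (Finset.mem_range.2 hx)), hj x h1 h2⟩))
    · exact Or.inr (Or.inl h2)
  · exact Or.inl h1

/-- The next list of pairs can always be found. -/
theorem exists_pairs (hW : ∀ p ∈ W, p.Prime) (hq : ∀ j, q j ∈ W) (m : ℕ) {K : ℕ} (hK : K ≠ 0) :
    ∃ C : List (ℕ × ℕ), (∀ c ∈ C, IsRamifiedPair c) ∧ (∀ c ∈ C, CoprimePair c K) ∧
      Excluded (firstValues q m) K C := by
  have h : ∀ p : ℕ, ∃ r, p.Prime → p ≠ 2 → r > K ∧ IsRamifiedPair (p, r) := by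
    intro p
    by_cases hp : p.Prime ∧ p ≠ 2
    · obtain ⟨r, hr⟩ := exists_isRamifiedPair hp.1 hp.2 K
      exact ⟨r, fun _ _ => hr⟩
    · exact ⟨0, fun h1 h2 => absurd ⟨h1, h2⟩ hp⟩
  choose r hr using h
  have hmem : ∀ p ∈ firstValues q m, p.Prime := by
    intro p hp
    obtain ⟨j, -, rfl⟩ := mem_firstValues.1 hp
    exact hW _ (hq j)
  -- Taking $r>K$ ensures that the partner prime does not divide $K$ either.
  refine ⟨((firstValues q m).filter fun p => ¬ p ∣ K ∧ p ≠ 2).map fun p => (p, r p), ?_, ?_, ?_⟩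
  · simp only [List.forall_mem_map, List.mem_filter, decide_eq_true_eq]
    exact fun p hp => (hr p (hmem p hp.1) hp.2.2).2
  · simp only [List.forall_mem_map, List.mem_filter, decide_eq_true_eq]
    exact fun p hp => ⟨hp.2.1, Nat.not_dvd_of_pos_of_lt (Nat.pos_of_ne_zero hK)
      (hr p (hmem p hp.1) hp.2.2).1⟩
  · intro p hp
    by_cases h1 : p ∣ K
    · exact Or.inl h1
    · by_cases h2 : p = 2
      · exact Or.inr (Or.inl h2)
      · refine Or.inr (Or.inr ⟨(p, r p), ?_, rfl⟩)
        exact List.mem_map.2 ⟨p, List.mem_filter.2 ⟨hp, by simp [h1, h2]⟩, rfl⟩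

/-- An integral zero has a common denominator that is prime to all pairs. -/
theorem exists_denominator (hW : ∀ p ∈ W, p.Prime) {e : ℕ} {C : List (ℕ × ℕ)}
    (hC : ∀ c ∈ C, IsRamifiedPair c)
    (h : PolyCode.integralZeroIndex e C ∈ HTP (invertRing W)) :
    ∃ (D : ℕ) (a : List (ℕ × ℕ)), D ≠ 0 ∧ (∀ p : ℕ, p.Prime → p ∣ D → p ∈ W) ∧
      (∀ c ∈ C, CoprimePair c D) ∧ PolyCode.pointIndex e D a ∈ HTP (invertRing W) := by
  obtain ⟨x, hxW, hxC, hx⟩ := (PolyCode.integralZeroIndex_mem_HTP hC).1 h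
  set N := PolyCode.bound (Denumerable.ofNat PolyCode e) with hN
  let D := ∏ i ∈ Finset.range N, (x i).den
  have hD : D ≠ 0 := Finset.prod_ne_zero_iff.2 fun i _ => (x i).den_ne_zero
  have hdvd : ∀ {p : ℕ}, p.Prime → p ∣ D → ∃ i, p ∣ (x i).den := by
    intro p hp hd
    obtain ⟨i, -, hi⟩ := (Prime.dvd_finsetProd_iff hp.prime _).1 hd
    exact ⟨i, hi⟩
  let u : ℕ → ℤ := fun i => (x i).num * (D / (x i).den : ℕ)
  have hu : ∀ i < N, (u i : ℚ) / D = x i := by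
    intro i hi
    have h1 : (x i).den ∣ D := Finset.dvd_prod_of_mem _ (Finset.mem_range.2 hi)
    have h2 : (((x i).den : ℚ)) * (D / (x i).den : ℕ) = D := by
      exact_mod_cast Nat.mul_div_cancel' h1
    have hD' : (D : ℚ) ≠ 0 := by exact_mod_cast hD
    rw [div_eq_iff hD', ← h2, ← mul_assoc, Rat.mul_den_eq_num]
    simp only [u]
    push_cast
    rfl
  -- Each integer numerator is stored as positive part minus negative part.
  let a : List (ℕ × ℕ) := (List.range N).map fun i => ((u i).toNat, (-u i).toNat)
  have ha : ∀ i < N, (((a.getD i (0, 0)).1 : ℚ) - (a.getD i (0, 0)).2) / D = x i := by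
    intro i hi
    have h1 : a.getD i (0, 0) = ((u i).toNat, (-u i).toNat) := by
      rw [List.getD_eq_getElem _ _ (by simpa [a] using hi)]
      simp [a]
    have h2 : (((u i).toNat : ℤ)) - ((-u i).toNat : ℤ) = u i := by omega
    have h3 : (((u i).toNat : ℚ)) - ((-u i).toNat : ℚ) = u i := by exact_mod_cast h2
    rw [h1, h3, hu i hi]
  refine ⟨D, a, hD, ?_, ?_, ?_⟩
  · intro p hp hd
    obtain ⟨i, hi⟩ := hdvd hp hd
    exact (mem_invertRing_iff hW _).1 (hxW i) p hp hi
  · intro c hc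
    refine ⟨fun hd => ?_, fun hd => ?_⟩
    · obtain ⟨i, hi⟩ := hdvd (hC c hc).1 hd
      exact (hxC i c hc).1 hi
    · obtain ⟨i, hi⟩ := hdvd (hC c hc).2.2.1 hd
      exact (hxC i c hc).2 hi
  · refine (PolyCode.pointIndex_mem_HTP hD).2 ⟨fun i hi => by rw [ha i hi]; exact hxW i, ?_⟩
    rw [← hx]
    exact PolyCode.eval_congr _ ha

/-- This guarantees that the search at every stage ends, whatever the oracle answers. -/
theorem Valid.exists_witness (hW : ∀ p ∈ W, p.Prime) (hqr : Set.range q = W) (n : ℕ) {s : State}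
    (hs : Valid W s) :
    ∃ w : Witness, Admissible q n s w ∧
      (PolyCode.integralZeroIndex n s.1 ∈ HTP (invertRing W) →
        PolyCode.pointIndex n w.1.1 w.2.1 ∈ HTP (invertRing W)) := by
  have hq : ∀ j, q j ∈ W := fun j => hqr ▸ Set.mem_range_self j
  obtain ⟨D, a, hD, hDW, hDC, hDa⟩ : ∃ (D : ℕ) (a : List (ℕ × ℕ)), D ≠ 0 ∧
      (∀ p : ℕ, p.Prime → p ∣ D → p ∈ W) ∧ (∀ c ∈ s.1, CoprimePair c D) ∧
      (PolyCode.integralZeroIndex n s.1 ∈ HTP (invertRing W) →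
        PolyCode.pointIndex n D a ∈ HTP (invertRing W)) := by
    by_cases h : PolyCode.integralZeroIndex n s.1 ∈ HTP (invertRing W)
    · obtain ⟨D, a, h1, h2, h3, h4⟩ := exists_denominator hW hs.pair h
      exact ⟨D, a, h1, h2, h3, fun _ => h4⟩
    -- After a negative answer nothing is demanded of the point, and $D=1$ adds no primes to $S$.
    · refine ⟨1, [], one_ne_zero, fun p hp hd => absurd (Nat.dvd_one.1 hd) hp.ne_one,
        fun c hc => ⟨fun hd => ?_, fun hd => ?_⟩, fun h' => absurd h' h⟩
      · exact (hs.pair c hc).1.ne_one (Nat.dvd_one.1 hd)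
      · exact (hs.pair c hc).2.2.1.ne_one (Nat.dvd_one.1 hd)
  obtain ⟨k, hk⟩ := exists_firstValues hqr hDW
  obtain ⟨C, hC1, hC2, hC3⟩ := exists_pairs hW hq ((s.2 * D + 1) * (n + 1))
    (mul_ne_zero hs.ne_zero hD)
  exact ⟨((D, k), a, C), ⟨hD, hk, hDC, hC1, hC2, hC3⟩, hDa⟩

end State

/-! ### Relative densities -/

section Density

open Filter

variable {W S : Set ℕ} {q : ℕ → ℕ}

theorem ncard_inter_image_Iio_le (S : Set ℕ) (q : ℕ → ℕ) (n : ℕ) :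
    (S ∩ q '' Set.Iio n).ncard ≤ n := by
  calc (S ∩ q '' Set.Iio n).ncard ≤ (q '' Set.Iio n).ncard :=
        Set.ncard_le_ncard Set.inter_subset_right ((Set.finite_Iio n).image q)
    _ ≤ (Set.Iio n).ncard := Set.ncard_image_le (Set.finite_Iio n)
    _ = n := by simp

theorem relProportion_nonneg (q : ℕ → ℕ) (S : Set ℕ) (n : ℕ) : 0 ≤ relProportion q S n :=
  div_nonneg (Nat.cast_nonneg _) (Nat.cast_nonneg _)

theorem relProportion_le_one (q : ℕ → ℕ) (S : Set ℕ) (n : ℕ) : relProportion q S n ≤ 1 :=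
  div_le_one_of_le₀ (by exact_mod_cast ncard_inter_image_Iio_le S q n) (Nat.cast_nonneg _)

theorem relProportion_diff (hinj : Function.Injective q) (hq : ∀ j, q j ∈ W) {n : ℕ}
    (hn : n ≠ 0) : relProportion q (W \ S) n = 1 - relProportion q S n := by
  have hfin : (q '' Set.Iio n).Finite := (Set.finite_Iio n).image q
  have h1 : (W \ S) ∩ q '' Set.Iio n = (q '' Set.Iio n) \ (S ∩ q '' Set.Iio n) := by
    ext p
    simp only [Set.mem_inter_iff, Set.mem_sdiff]
    constructor
    · rintro ⟨⟨h1, h2⟩, h3⟩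
      exact ⟨h3, fun h => h2 h.1⟩
    · rintro ⟨⟨j, hj, rfl⟩, h2⟩
      exact ⟨⟨hq j, fun h => h2 ⟨h, j, hj, rfl⟩⟩, j, hj, rfl⟩
  have h2 : (q '' Set.Iio n).ncard = n := by
    rw [Set.ncard_image_of_injective _ hinj]
    simp
  have h3 := Set.ncard_sdiff_add_ncard_of_subset (s := S ∩ q '' Set.Iio n) (t := q '' Set.Iio n)
    Set.inter_subset_right hfin
  rw [h2, ← h1] at h3
  have h4 : (((W \ S) ∩ q '' Set.Iio n).ncard : ℝ) + ((S ∩ q '' Set.Iio n).ncard : ℝ) = n := by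
    exact_mod_cast h3
  have hn' : (n : ℝ) ≠ 0 := by exact_mod_cast hn
  rw [relProportion, relProportion, eq_sub_iff_add_eq, ← add_div, h4, div_self hn']

theorem relLowerDensity_eq_zero
    (h : ∀ ε > 0, ∃ᶠ n in atTop, relProportion q S n ≤ ε) : relLowerDensity q S = 0 := by
  have hb : IsCoboundedUnder (· ≥ ·) atTop (relProportion q S) :=
    IsBoundedUnder.isCoboundedUnder_ge (isBoundedUnder_of ⟨1, relProportion_le_one q S⟩)
  have hb' : IsBoundedUnder (· ≥ ·) atTop (relProportion q S) := isBoundedUnder_of ⟨0, relProportion_nonneg q S⟩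
  refine le_antisymm (le_of_forall_pos_le_add fun ε hε => ?_) ?_
  · rw [zero_add]
    exact liminf_le_of_frequently_le (h ε hε) hb'
  · exact le_liminf_of_le hb (Eventually.of_forall (relProportion_nonneg q S))

theorem relUpperDensity_diff_eq_one (hinj : Function.Injective q) (hq : ∀ j, q j ∈ W)
    (h : ∀ ε > 0, ∃ᶠ n in atTop, relProportion q S n ≤ ε) : relUpperDensity q (W \ S) = 1 := by
  have hb : IsCoboundedUnder (· ≤ ·) atTop (relProportion q (W \ S)) :=
    IsBoundedUnder.isCoboundedUnder_le (isBoundedUnder_of ⟨0, relProportion_nonneg q (W \ S)⟩)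
  have hb' : IsBoundedUnder (· ≤ ·) atTop (relProportion q (W \ S)) := isBoundedUnder_of ⟨1, relProportion_le_one q (W \ S)⟩
  refine le_antisymm ?_ (le_of_forall_pos_le_add fun ε hε => ?_)
  · exact limsup_le_of_le hb (Eventually.of_forall (relProportion_le_one q (W \ S)))
  · rw [← sub_le_iff_le_add]
    refine le_limsup_of_frequently_le ?_ hb'
    refine ((h ε hε).and_eventually (eventually_ne_atTop 0)).mono fun n hn => ?_
    rw [relProportion_diff hinj hq hn.2]
    linarith [hn.1]

end Density

/-! ### Assembly of the set $S$ -/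

theorem theoremT (W : Set ℕ) (hWprime : ∀ p ∈ W, p.Prime) (hWinf : W.Infinite)
    (hWce : REPred (fun p : ℕ => p ∈ W))
    (q : ℕ → ℕ) (hq : IsComputableEnumeration q W) :
    ∃ S : Set ℕ, S ⊆ W ∧
      relUpperDensity q (W \ S) = 1 ∧
      SetTuringReducible (HTP (invertRing S)) (HTP (invertRing W)) ∧
      relLowerDensity q S = 0 := by
  classical
  have hqW : ∀ j, q j ∈ W := fun j => hq.range_eq ▸ Set.mem_range_self j
  obtain ⟨st, -, hvalid, hstep, hred⟩ := exists_stages_turingReducible (σ := State) (ω := Witness)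
    (HTP (invertRing W)) (([], 1) : State)
    (T := fun n s w => decide (State.Admissible q n s w))
    (Q₁ := fun n s => PolyCode.integralZeroIndex n s.1)
    (Q₂ := fun n _ w => PolyCode.pointIndex n w.1.1 w.2.1) (U := State.update)
    (State.computable_admissible hq.computable)
    (by
      have h : Primrec fun t : ℕ × State => PolyCode.integralZeroIndex t.1 t.2.1 :=
        PolyCode.primrec_integralZeroIndex.comp Primrec.fst (Primrec.fst.comp Primrec.snd)
      exact Computable₂.mk h.to_comp)
    (by
      have h : Primrec fun t : (ℕ × State) × Witness => (t.1.1, t.2.1.1, t.2.2.1) :=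
        Primrec.pair (Primrec.fst.comp Primrec.fst)
          (Primrec.pair (Primrec.fst.comp (Primrec.fst.comp Primrec.snd))
            (Primrec.fst.comp (Primrec.snd.comp Primrec.snd)))
      exact (PolyCode.primrec_pointIndex.comp h).to_comp)
    State.computable_update (fun _ s => s.Valid W)
    ⟨by simp, by simp, one_ne_zero, fun p hp hd => absurd (Nat.dvd_one.1 hd) hp.ne_one⟩
    (fun n s hs => by simpa using hs.exists_witness hWprime hq.range_eq n)
    (fun n s w hs hw _ => hs.update hqW (of_decide_eq_true hw))
  have hdvd : ∀ {m n}, m ≤ n → (st m).2 ∣ (st n).2 := by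
    intro m n h
    induction n, h using Nat.le_induction with
    | base => exact dvd_rfl
    | succ n _ ih =>
      obtain ⟨w, -, -, hw⟩ := hstep n
      exact ih.trans (hw ▸ dvd_mul_right _ _)
  have hsub : ∀ {m n}, m ≤ n → ∀ c ∈ (st m).1, c ∈ (st n).1 := by
    intro m n h
    induction n, h using Nat.le_induction with
    | base => exact fun c hc => hc
    | succ n _ ih =>
      obtain ⟨w, -, -, hw⟩ := hstep n
      exact fun c hc => hw ▸ List.mem_append_left _ (ih c hc)
  let S : Set ℕ := {p | p ∈ W ∧ ∃ n, p ∣ (st n).2}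
  have hSW : S ⊆ W := fun p hp => hp.1
  have hSprime : ∀ p ∈ S, p.Prime := fun p hp => hWprime p hp.1
  -- A forbidden pair and a prime put into $S$ at different stages are compared at the later one,
  -- where the state is still coprime to all its pairs.
  have hpair : ∀ n, ∀ c ∈ (st n).1, c.1 ∉ S ∧ c.2 ∉ S := by
    intro n c hc
    refine ⟨?_, ?_⟩ <;> rintro ⟨-, m, hm⟩
    · exact ((hvalid (max n m)).coprime c (hsub (le_max_left n m) c hc)).1
        (hm.trans (hdvd (le_max_right n m)))
    · exact ((hvalid (max n m)).coprime c (hsub (le_max_left n m) c hc)).2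
        (hm.trans (hdvd (le_max_right n m)))
  -- A zero over $\mathbb{Z}[S^{-1}]$ is integral at every forbidden pair, so the question at its
  -- stage is answered yes. Conversely, a yes produces a zero whose denominators divide a number $D$
  -- with all prime factors in $S$.
  have hHTP : HTP (invertRing S) =
      {n | PolyCode.integralZeroIndex n (st n).1 ∈ HTP (invertRing W)} := by
    ext e
    rw [Set.mem_ofPred_eq]
    constructor
    · intro he
      obtain ⟨x, hx, h0⟩ := (PolyCode.mem_HTP _ e).1 he
      have hx' := fun i => (mem_invertRing_iff hSprime (x i)).1 (hx i)
      refine (PolyCode.integralZeroIndex_mem_HTP (hvalid e).pair).2 ⟨x, fun i => ?_,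
        fun i c hc => ⟨fun hd => ?_, fun hd => ?_⟩, h0⟩
      · exact (mem_invertRing_iff hWprime (x i)).2 fun p hp hd => hSW (hx' i p hp hd)
      · exact (hpair e c hc).1 (hx' i _ ((hvalid e).pair c hc).1 hd)
      · exact (hpair e c hc).2 (hx' i _ ((hvalid e).pair c hc).2.2.1 hd)
    · intro he
      obtain ⟨w, hw, hQ, hst⟩ := hstep e
      obtain ⟨hD, hfac, -⟩ : State.Admissible q e (st e) w := of_decide_eq_true hw
      obtain ⟨-, h0⟩ := (PolyCode.pointIndex_mem_HTP hD).1 (hQ he)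
      refine (PolyCode.mem_HTP _ e).2 ⟨_, fun i => ?_, h0⟩
      refine (mem_invertRing_iff hSprime _).2 fun p hp hd => ?_
      -- Past the end of the list the default $(0,0)$ gives the coordinate $0$.
      set a := w.2.1.getD i (0, 0)
      have hden : ((((a.1 : ℚ) - a.2) / w.1.1).den : ℤ) ∣ w.1.1 := by
        have := Rat.den_dvd ((a.1 : ℤ) - a.2) (w.1.1 : ℤ)
        rw [Rat.divInt_eq_div] at this
        push_cast at this
        exact this
      have hpD : p ∣ w.1.1 := hd.trans (Int.natCast_dvd_natCast.1 hden)
      obtain ⟨j, -, hj⟩ := mem_firstValues.1 (PrimeFactorsIn.mem hfac hD hp hpD)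
      refine ⟨hj ▸ hqW j, e + 1, hst ▸ ?_⟩
      exact hpD.mul_left _
  have hfreq : ∀ ε > 0, ∃ᶠ n in Filter.atTop, relProportion q S n ≤ ε := by
    intro ε hε
    rw [Filter.frequently_atTop]
    intro b
    obtain ⟨k, hk⟩ := exists_nat_one_div_lt hε
    -- The bound $b$ makes the index large, and $k$ makes $1/(n+1)$ smaller than $\varepsilon$.
    set n := max b k with hn
    obtain ⟨w, hw, -, hst⟩ := hstep n
    obtain ⟨-, -, -, -, -, hex⟩ : State.Admissible q n (st n) w := of_decide_eq_true hw
    have hK : (st (n + 1)).2 = (st n).2 * w.1.1 := by rw [hst]; rfl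
    rw [← hK] at hex
    set K := (st (n + 1)).2
    have hK0 : K ≠ 0 := (hvalid (n + 1)).ne_zero
    -- A value of $q$ in this range that lies in $S$ is not forbidden, so it divides $K$ or equals
    -- $2$, the one prime that never starts a ramified pair.
    have hcover : S ∩ q '' Set.Iio ((K + 1) * (n + 1)) ⊆
        ((insert 2 (Finset.Icc 1 K) : Finset ℕ) : Set ℕ) := by
      rintro p ⟨hpS, j, hj, rfl⟩
      rw [Finset.coe_insert, Set.mem_insert_iff, Finset.mem_coe, Finset.mem_Icc]
      rcases hex (q j) (mem_firstValues.2 ⟨j, hj, rfl⟩) with h | h | ⟨c, hc, h⟩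
      · exact Or.inr ⟨(hSprime _ hpS).one_le, Nat.le_of_dvd (Nat.pos_of_ne_zero hK0) h⟩
      · exact Or.inl h
      · refine absurd hpS (h ▸ (hpair (n + 1) c ?_).1)
        rw [hst]
        exact List.mem_append_right _ hc
    have hcard : (S ∩ q '' Set.Iio ((K + 1) * (n + 1))).ncard ≤ K + 1 := by
      refine (Set.ncard_le_ncard hcover (Finset.finite_toSet _)).trans ?_
      rw [Set.ncard_coe_finset]
      exact (Finset.card_insert_le _ _).trans (by simp)
    refine ⟨(K + 1) * (n + 1), ?_, ?_⟩
    · calc b ≤ n + 1 := (le_max_left b k).trans (Nat.le_succ _)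
        _ ≤ (K + 1) * (n + 1) := Nat.le_mul_of_pos_left _ (Nat.succ_pos K)
    · have hn1 : (0 : ℝ) < n + 1 := by positivity
      have hK1 : (0 : ℝ) < K + 1 := by positivity
      have hkn : (k : ℝ) ≤ n := by exact_mod_cast le_max_right b k
      calc relProportion q S ((K + 1) * (n + 1))
          ≤ ((K : ℝ) + 1) / (((K + 1) * (n + 1) : ℕ) : ℝ) := by
            rw [relProportion]
            gcongr
            exact_mod_cast hcard
        _ = 1 / ((n : ℝ) + 1) := by push_cast; field_simp
        _ ≤ 1 / ((k : ℝ) + 1) := by gcongr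
        _ ≤ ε := hk.le
  refine ⟨S, hSW, relUpperDensity_diff_eq_one hq.injective hqW hfreq, ?_,
    relLowerDensity_eq_zero hfreq⟩
  rw [hHTP]
  exact hred
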